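/- **Setting.** Let $l\ge 1$ and let $y(t)\in\mathbb R^p$, $u(t)\in\mathbb R^m$, $w(t)\in\mathbb R^{m_w}$ ($-l\le t\le N-1$) be recorded signals. Put $$\chi(t)=\mathrm{col}\big(y(t-1),\dots,y(t-l),\,u(t-1),\dots,u(t-l),\,w(t-1),\dots,w(t-l)\big),$$ $Y=(y(0)\cdots y(N-1))$, $X=(\chi(0)\cdots\chi(N-1))$, $U_0=(u(0)\cdots u(N-1))$, $W=(w(0)\cdots w(N-1))$. Let $J_A,J_B,J_{B_1}$ be the constant 0/1 shift matrices for which, for all signals, $\chi(t+1)=\mathrm{col}\big(y(t),\,J_A\chi(t)+J_Bu(t)+J_{B_1}w(t)\big)$. Let $X=X_s\Sigma_\chi X_r^\top$ be a compact singular value decomposition with $X_s$ having $\tilde n$ columns, and $X_d=\Sigma_\chi X_r^\top$. Let $B_{d0}\in\mathbb R^{p\times m_d}$ have full column rank, and let $\Phi=\Phi^\top=\begin{pmatrix}\Phi_{11}&\Phi_{12}\\ \Phi_{12}^\top&\Phi_{22}\end{pmatrix}\in\mathbb R^{(m_d+N)\times(m_d+N)}$ with $\Phi_{22}\prec0$.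 Let $\Sigma$ be the set of all triples $(\bar A_s,B_{u0},B_{w0})\in\mathbb R^{p\times\tilde n}\times\mathbb R^{p\times m}\times\mathbb R^{p\times m_w}$ such that $$Y=\bar A_sX_d+B_{u0}U_0+B_{w0}W+B_{d0}W_d\quad\text{for some }W_d\text{ with}\quad \begin{pmatrix}I\\W_d^\top\end{pmatrix}^{\!\top}\Phi\begin{pmatrix}I\\W_d^\top\end{pmatrix}\succeq0 .$$ Assume that the first $p$ rows of $X$ are linearly independent, that $\Sigma\ne\emptyset$, and that $\mathrm{rank}\,\mathrm{col}(X_d,U_0,W)=\tilde n+m+m_w$. **Closed loop.** Let $\hat C_1,E,D_1,\hat C$ be given matrices of compatible sizes ($z=\hat C_1\chi+Eu+D_1w\in\mathbb R^{p_z}$, $y_c=\hat C\chi$), $C_1=\hat C_1X_s$, $C=\hat CX_s$. For a triple $(\bar A_s,B_{u0},B_{w0})$ put $$A=X_s^\top\begin{pmatrix}\bar A_s\\J_AX_s\end{pmatrix},\quad B=X_s^\top\begin{pmatrix}B_{u0}\\J_B\end{pmatrix},\quad B_1=X_s^\top\begin{pmatrix}B_{w0}\\J_{B_1}\end{pmatrix},$$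 and for a controller $(A_c,B_c,C_c,D_c)$ of order $\tilde n$ $$\tilde A=\begin{pmatrix}A+BD_cC&BC_c\\B_cC&A_c\end{pmatrix},\quad \tilde B=\begin{pmatrix}B_1\\0\end{pmatrix},\quad \tilde C=\begin{pmatrix}C_1+ED_cC&EC_c\end{pmatrix},\quad \tilde D=D_1 .$$ **Auxiliary matrices.** Let $H=G\Phi G^\top$ with $G=\begin{pmatrix}B_{d0}&Y\\0&-\mathrm{col}(X_d,U_0,W)\end{pmatrix}$, partitioned as $H=(H_{ij})_{i,j=1}^4$ with block sizes $p,\tilde n,m,m_w$; write $H_\circ=(H_{ij})_{i,j=2}^4$ and $h=(H_{12}\ H_{13}\ H_{14})$. Put $(\check A_s\ \check B_{u0}\ \check B_{w0})^\top=-H_\circ^{-1}h^\top$, let $\check A,\check B,\check B_1$ be the matrices $A,B,B_1$ of the triple $(\check A_s,\check B_{u0},\check B_{w0})$, and let $\bar h^\top=h^\top+H_\circ(\check A_s\ \check B_{u0}\ \check B_{w0})^\top$. Let $\Lambda\in\mathbb R^{\tilde p\times\tilde p}$, $\Lambda\succ0$, and $\Xi\in\mathbb R^{p\times\tilde p}$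 be any matrices with $$(I\ \check A_s\ \check B_{u0}\ \check B_{w0})\,H\,(I\ \check A_s\ \check B_{u0}\ \check B_{w0})^\top=\Xi\Lambda\Xi^\top .$$ Let $X_{s1}$ consist of the first $p$ rows of $X_s$, let $L_1\in\mathbb R^{(\tilde n-p)\times\tilde n}$ be any matrix whose rows form a basis of $\ker X_{s1}$, and $L=\mathrm{col}\big(L_1,(X_{s1}X_{s1}^\top)^{-1}X_{s1}\big)$. For a scalar $\alpha$ and matrices $\bar X,\bar Y,\tilde A_c,\tilde B_c,\tilde C_c,D_c$ let $$\Pi=\begin{pmatrix}\Pi_{11}&\Pi_{12}\\\Pi_{12}^\top&\Pi_{22}\end{pmatrix},\qquad \Pi_{11}=\begin{pmatrix}\bar X&I&0\\I&\bar Y&0\\0&0&I_{m_w}\end{pmatrix},\qquad \Pi_{12}^\top=\begin{pmatrix}\check A+\check BD_cC&\check A\bar Y+\check B\tilde C_c&\check B_1\\ \bar X\check A+\tilde B_cC&\tilde A_c&\bar X\check B_1\\ I&\bar Y&0\\ D_cC&\tilde C_c&0\\0&0&I_{m_w}\\0_{\tilde p\times\tilde n}&0&0\end{pmatrix},$$ $$\Pi_{22}=\begin{pmatrix}\bar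 Y&I&\star&\star\\ I&\bar X&\star&\star\\ (0\ \ {-\alpha}\bar h^\top)L^{-\top}&(0\ \ {-\alpha}\bar h^\top)L^{-\top}\bar X&-\alpha H_\circ&\star\\ (0\ \ \alpha\Xi^\top)L^{-\top}&(0\ \ \alpha\Xi^\top)L^{-\top}\bar X&0&\alpha\Lambda^{-1}\end{pmatrix},\qquad \Delta=\begin{pmatrix}I&D_1^\top&0&0\\ \star&Z&C_1+ED_cC&C_1\bar Y+E\tilde C_c\\ \star&\star&\bar X&I\\ \star&\star&\star&\bar Y\end{pmatrix},$$ where $\star$ denotes blocks determined by symmetry. **Theorem.** Let $\mu\in\mathbb R$ and $Z\in\mathbb R^{p_z\times p_z}$. The following are equivalent: (i) there are a controller $(A_c,B_c,C_c,D_c)$ of order $\tilde n$ and a matrix $P$ such that for all $(\bar A_s,B_{u0},B_{w0})\in\Sigma$ $$\mathrm{tr}(Z)<\mu^2,\qquad \begin{pmatrix}I&\tilde B^\top\\ \tilde B&P-\tilde AP\tilde A^\top\end{pmatrix}\succ0,\qquad \begin{pmatrix}Z-\tilde D\tilde D^\top&\tilde CP\\P\tilde C^\top&P\end{pmatrix}\succ0;$$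 (ii) $\mathrm{tr}(Z)<\mu^2$, $\Pi\succ0$ and $\Delta\succ0$ for some real scalar $\alpha$, symmetric matrices $\bar X,\bar Y$ and matrices $\tilde A_c,\tilde B_c,\tilde C_c,D_c$. Furthermore, for every solution of (ii) and every full-rank (i.e. invertible) $V\in\mathbb R^{\tilde n\times\tilde n}$, the matrix $U=(I-\bar X\bar Y)V^{-\top}$ is invertible, and the controller consisting of $D_c$ and $$B_c=U^{-1}(\tilde B_c-\bar X\check BD_c),\quad C_c=(\tilde C_c-D_cC\bar Y)V^{-\top},\quad A_c=U^{-1}\big(\tilde A_c-\bar X(\check A\bar Y+\check B\tilde C_c)-UB_cC\bar Y\big)V^{-\top}$$ satisfies the inequalities in (i), for all triples in $\Sigma$, with some matrix $P$. -/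

import Mathlib

open Matrix

noncomputable section

namespace DataDrivenH2

/-- Index set of all entries of the extended state `χ(t)` except the first block `y(t-1)`:
`y(t-2),…,y(t-l)`, then `u(t-1),…,u(t-l)`, then `w(t-1),…,w(t-l)`, where the lag is `l = k+1`. -/
abbrev RestIdx (k p m mw : ℕ) : Type :=
  (Fin k × Fin p) ⊕ (Fin (k + 1) × Fin m) ⊕ (Fin (k + 1) × Fin mw)

/-- Index set of the extended state `χ(t)`; the first summand is the block `y(t-1)`. -/
abbrev StateIdx (k p m mw : ℕ) : Type := Fin p ⊕ RestIdx k p m mw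

section Realization

variable {k p m mw : ℕ}

/-- Position of `y_i(t-1-j)` in `χ(t)`, for `j = 0,…,l-1`. -/
def yPos (j : Fin (k + 1)) (i : Fin p) : StateIdx k p m mw :=
  Fin.cases (Sum.inl i) (fun j' => Sum.inr (Sum.inl (j', i))) j

/-- Position of `u_i(t-1-j)` in `χ(t)`. -/
def uPos (j : Fin (k + 1)) (i : Fin m) : StateIdx k p m mw := Sum.inr (Sum.inr (Sum.inl (j, i)))

/-- Position of `w_i(t-1-j)` in `χ(t)`. -/
def wPos (j : Fin (k + 1)) (i : Fin mw) : StateIdx k p m mw := Sum.inr (Sum.inr (Sum.inr (j, i)))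

/-- The extended state `χ(t)`: the last `l = k+1` values of `y`, `u` and `w` before time `t`. -/
def chi (y : ℤ → Fin p → ℝ) (u : ℤ → Fin m → ℝ) (w : ℤ → Fin mw → ℝ) (t : ℤ) :
    StateIdx k p m mw → ℝ
  | Sum.inl i => y (t - 1) i
  | Sum.inr (Sum.inl (j, i)) => y (t - 2 - (j : ℕ)) i
  | Sum.inr (Sum.inr (Sum.inl (j, i))) => u (t - 1 - (j : ℕ)) i
  | Sum.inr (Sum.inr (Sum.inr (j, i))) => w (t - 1 - (j : ℕ)) i

/-- The shift matrix `J_A`. -/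
def JA : Matrix (RestIdx k p m mw) (StateIdx k p m mw) ℝ := Matrix.of fun r c =>
  match r with
  | Sum.inl (j, i) => if c = yPos j.castSucc i then 1 else 0
  | Sum.inr (Sum.inl (j, i)) =>
      Fin.cases (0 : ℝ) (fun j' => if c = uPos j'.castSucc i then 1 else 0) j
  | Sum.inr (Sum.inr (j, i)) =>
      Fin.cases (0 : ℝ) (fun j' => if c = wPos j'.castSucc i then 1 else 0) j

/-- The matrix `J_B`: the input `u(t)` enters the block of `χ(t+1)` holding `u(t)`. -/
def JB : Matrix (RestIdx k p m mw) (Fin m) ℝ := Matrix.of fun r c =>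
  match r with
  | Sum.inr (Sum.inl (j, i)) => if j = 0 ∧ i = c then 1 else 0
  | _ => 0

/-- The matrix `J_{B_1}`: the input `w(t)` enters the block of `χ(t+1)` holding `w(t)`. -/
def JB1 : Matrix (RestIdx k p m mw) (Fin mw) ℝ := Matrix.of fun r c =>
  match r with
  | Sum.inr (Sum.inr (j, i)) => if j = 0 ∧ i = c then 1 else 0
  | _ => 0

end Realization

/-- Inverse of an invertible matrix whose rows and columns are labelled by different index sets. -/
def rectInv {a b : Type*} [Fintype a] [Fintype b] [DecidableEq b] (M : Matrix a b ℝ) :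
    Matrix b a ℝ := (Mᵀ * M)⁻¹ * Mᵀ

/-- `rectInv` is the two-sided inverse whenever there is one. -/
theorem rectInv_eq {a b : Type*} [Fintype a] [Fintype b] [DecidableEq a] [DecidableEq b]
    (M : Matrix a b ℝ) (R : Matrix b a ℝ) (h1 : M * R = 1) (h2 : R * M = 1) :
    rectInv M = R := by
  have h3 : (Mᵀ * M) * (R * Rᵀ) = 1 := by
    rw [Matrix.mul_assoc, ← Matrix.mul_assoc M, h1, Matrix.one_mul, ← Matrix.transpose_mul, h2,
      Matrix.transpose_one]
  rw [rectInv, Matrix.inv_eq_right_inv h3, Matrix.mul_assoc, ← Matrix.transpose_mul, h1,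
    Matrix.transpose_one, Matrix.mul_one]

/-- The objects that are known or chosen by the designer. Dimensions: lag `l = k+1`, output `p`,
control input `m`, performance input `mw`, noise `md`, number `N` of data columns, controlled
output `pz`, controller input `pc`, rank `n` of the state data matrix, size `q` of the factor `Λ`.
Only data fields; all requirements on them are hypotheses of the theorem. -/
structure Setup (k p m mw md N pz pc n q : ℕ) where
  /-- recorded output; only the times `-l,…,N-1` matter -/
  y : ℤ → Fin p → ℝ
  /-- recorded control input -/
  u : ℤ → Fin m → ℝ
  /-- recorded performance input -/
  w : ℤ → Fin mw → ℝ
  /-- noise input matrix `B_{d0}` -/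
  Bd0 : Matrix (Fin p) (Fin md) ℝ
  /-- noise bound -/
  Φ : Matrix (Fin md ⊕ Fin N) (Fin md ⊕ Fin N) ℝ
  /-- `Ĉ₁`, with `z = Ĉ₁ χ + E u + D₁ w` -/
  C1hat : Matrix (Fin pz) (StateIdx k p m mw) ℝ
  E : Matrix (Fin pz) (Fin m) ℝ
  D1 : Matrix (Fin pz) (Fin mw) ℝ
  /-- `Ĉ`, with controller input `y_c = Ĉ χ` -/
  Chat : Matrix (Fin pc) (StateIdx k p m mw) ℝ
  /-- left factor of the compact singular value decomposition of the state data -/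
  Xs : Matrix (StateIdx k p m mw) (Fin n) ℝ
  /-- the nonzero singular values -/
  sv : Fin n → ℝ
  /-- right factor of the compact singular value decomposition -/
  Xr : Matrix (Fin N) (Fin n) ℝ
  L1 : Matrix (Fin (n - p)) (Fin n) ℝ
  Ξ : Matrix (Fin p) (Fin q) ℝ
  Λ : Matrix (Fin q) (Fin q) ℝ

/-- Dynamic output-feedback controller of order `n`. -/
structure Controller (m pc n : ℕ) where
  Ac : Matrix (Fin n) (Fin n) ℝ
  Bc : Matrix (Fin n) (Fin pc) ℝ
  Cc : Matrix (Fin m) (Fin n) ℝ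
  Dc : Matrix (Fin m) (Fin pc) ℝ

/-- Decision variables of the synthesis inequalities:
`α`, `X̄`, `Ȳ`, `Ã_c`, `B̃_c`, `C̃_c`, `D_c`. -/
structure DecisionVars (m pc n : ℕ) where
  α : ℝ
  Xb : Matrix (Fin n) (Fin n) ℝ
  Yb : Matrix (Fin n) (Fin n) ℝ
  At : Matrix (Fin n) (Fin n) ℝ
  Bt : Matrix (Fin n) (Fin pc) ℝ
  Ct : Matrix (Fin m) (Fin n) ℝ
  Dc : Matrix (Fin m) (Fin pc) ℝ

namespace Setup

variable {k p m mw md N pz pc n q : ℕ} (S : Setup k p m mw md N pz pc n q)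

/-! ### Data matrices -/

/-- `Y = (y(0) ⋯ y(N-1))`. -/
def Y : Matrix (Fin p) (Fin N) ℝ := Matrix.of fun i t => S.y (t : ℕ) i

/-- `X = (χ(0) ⋯ χ(N-1))`. -/
def X : Matrix (StateIdx k p m mw) (Fin N) ℝ := Matrix.of fun i t => chi S.y S.u S.w (t : ℕ) i

/-- `U = (u(0) ⋯ u(N-1))`. -/
def U : Matrix (Fin m) (Fin N) ℝ := Matrix.of fun i t => S.u (t : ℕ) i

/-- `W = (w(0) ⋯ w(N-1))`. -/
def W : Matrix (Fin mw) (Fin N) ℝ := Matrix.of fun i t => S.w (t : ℕ) i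

/-- `X = X_s diag(σ) X_rᵀ` is a compact singular value decomposition. -/
def IsCompactSVD : Prop :=
  S.X = S.Xs * Matrix.diagonal S.sv * S.Xrᵀ ∧ S.Xsᵀ * S.Xs = 1 ∧ S.Xrᵀ * S.Xr = 1 ∧
    ∀ i, 0 < S.sv i

/-- `X_d`. -/
def Xd : Matrix (Fin n) (Fin N) ℝ := Matrix.diagonal S.sv * S.Xrᵀ

/-- `col(X_d, U, W)`. -/
def regressor : Matrix (Fin n ⊕ Fin m ⊕ Fin mw) (Fin N) ℝ := fromRows S.Xd (fromRows S.U S.W)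

/-! ### Plants consistent with the data -/

/-- `col(I, W_dᵀ)`. -/
def noiseCol (Wd : Matrix (Fin md) (Fin N) ℝ) : Matrix (Fin md ⊕ Fin N) (Fin md) ℝ :=
  fromRows 1 Wdᵀ

/-- The quadratic matrix inequality bounding the noise data `W_d`. -/
def NoiseBound (Wd : Matrix (Fin md) (Fin N) ℝ) : Prop :=
  ((noiseCol Wd)ᵀ * S.Φ * noiseCol Wd).PosSemidef

/-- The set `Σ` of the triples `(Ā_s, B_{u0}, B_{w0})` that explain the data. -/
def Sigma : Set (Matrix (Fin p) (Fin n) ℝ × Matrix (Fin p) (Fin m) ℝ × Matrix (Fin p) (Fin mw) ℝ) :=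
  {T | ∃ Wd : Matrix (Fin md) (Fin N) ℝ, S.NoiseBound Wd ∧
    S.Y = T.1 * S.Xd + T.2.1 * S.U + T.2.2 * S.W + S.Bd0 * Wd}

/-! ### Reduced realization and closed loop -/

/-- `A = X_sᵀ Â X_s` with `Â X_s = col(Ā_s, J_A X_s)`, as a function of `Ā_s`. -/
def A (As : Matrix (Fin p) (Fin n) ℝ) : Matrix (Fin n) (Fin n) ℝ :=
  S.Xsᵀ * fromRows As (JA * S.Xs)

/-- `B = X_sᵀ B̂` with `B̂ = col(B_{u0}, J_B)`. -/
def B (Bu : Matrix (Fin p) (Fin m) ℝ) : Matrix (Fin n) (Fin m) ℝ := S.Xsᵀ * fromRows Bu JB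

/-- `B₁ = X_sᵀ B̂₁` with `B̂₁ = col(B_{w0}, J_{B_1})`. -/
def B1 (Bw : Matrix (Fin p) (Fin mw) ℝ) : Matrix (Fin n) (Fin mw) ℝ := S.Xsᵀ * fromRows Bw JB1

/-- `C₁ = Ĉ₁ X_s`. -/
def C1 : Matrix (Fin pz) (Fin n) ℝ := S.C1hat * S.Xs

/-- `C = Ĉ X_s`. -/
def C : Matrix (Fin pc) (Fin n) ℝ := S.Chat * S.Xs

/-- The closed-loop matrix `Ã`. -/
def clA (K : Controller m pc n) (As : Matrix (Fin p) (Fin n) ℝ) (Bu : Matrix (Fin p) (Fin m) ℝ) :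
    Matrix (Fin n ⊕ Fin n) (Fin n ⊕ Fin n) ℝ :=
  fromBlocks (S.A As + S.B Bu * K.Dc * S.C) (S.B Bu * K.Cc) (K.Bc * S.C) K.Ac

/-- The closed-loop matrix `B̃`. -/
def clB (Bw : Matrix (Fin p) (Fin mw) ℝ) : Matrix (Fin n ⊕ Fin n) (Fin mw) ℝ :=
  fromRows (S.B1 Bw) 0

/-- The closed-loop matrix `C̃`. -/
def clC (K : Controller m pc n) : Matrix (Fin pz) (Fin n ⊕ Fin n) ℝ :=
  fromCols (S.C1 + S.E * K.Dc * S.C) (S.E * K.Cc)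

/-- The closed-loop matrix `D̃`. -/
def clD : Matrix (Fin pz) (Fin mw) ℝ := S.D1

/-- The `H₂` inequalities for the closed loop of the controller `K`, with the certificates `P` and
`Z` common to all triples in `Σ`. -/
def H2Robust (μ : ℝ) (Z : Matrix (Fin pz) (Fin pz) ℝ) (K : Controller m pc n)
    (P : Matrix (Fin n ⊕ Fin n) (Fin n ⊕ Fin n) ℝ) : Prop :=
  ∀ As Bu Bw, (As, Bu, Bw) ∈ S.Sigma →
    Z.trace < μ ^ 2 ∧
    (fromBlocks (1 : Matrix (Fin mw) (Fin mw) ℝ) (S.clB Bw)ᵀ (S.clB Bw)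
      (P - S.clA K As Bu * P * (S.clA K As Bu)ᵀ)).PosDef ∧
    (fromBlocks (Z - S.clD * S.clDᵀ) (S.clC K * P) (P * (S.clC K)ᵀ) P).PosDef

/-! ### Auxiliary matrices -/

/-- The outer factor `(B_{d0} Y; 0 -col(X_d, U, W))` of `H`. -/
def Hfac : Matrix (Fin p ⊕ (Fin n ⊕ Fin m ⊕ Fin mw)) (Fin md ⊕ Fin N) ℝ :=
  fromBlocks S.Bd0 S.Y 0 (-S.regressor)

/-- The matrix `H` describing `Σ`. -/
def H : Matrix (Fin p ⊕ (Fin n ⊕ Fin m ⊕ Fin mw)) (Fin p ⊕ (Fin n ⊕ Fin m ⊕ Fin mw)) ℝ :=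
  S.Hfac * S.Φ * S.Hfacᵀ

/-- The block row `(H₁₂ H₁₃ H₁₄)`. -/
def Htop : Matrix (Fin p) (Fin n ⊕ Fin m ⊕ Fin mw) ℝ := S.H.toBlocks₁₂

/-- The lower right `3 × 3` block part of `H`. -/
def Hlow : Matrix (Fin n ⊕ Fin m ⊕ Fin mw) (Fin n ⊕ Fin m ⊕ Fin mw) ℝ := S.H.toBlocks₂₂

/-- `(Ǎ_s B̌_{u0} B̌_{w0})ᵀ`. -/
def checkT : Matrix (Fin n ⊕ Fin m ⊕ Fin mw) (Fin p) ℝ := -(S.Hlow⁻¹ * S.Htopᵀ)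

/-- `Ǎ_s`. -/
def checkAs : Matrix (Fin p) (Fin n) ℝ := S.checkT.toRows₁ᵀ

/-- `B̌_{u0}`. -/
def checkBu : Matrix (Fin p) (Fin m) ℝ := S.checkT.toRows₂.toRows₁ᵀ

/-- `B̌_{w0}`. -/
def checkBw : Matrix (Fin p) (Fin mw) ℝ := S.checkT.toRows₂.toRows₂ᵀ

/-- `col(I, Ǎ_sᵀ, B̌_{u0}ᵀ, B̌_{w0}ᵀ)`. -/
def checkCol : Matrix (Fin p ⊕ (Fin n ⊕ Fin m ⊕ Fin mw)) (Fin p) ℝ := fromRows 1 S.checkT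

/-- `Λ ≻ 0` and `Ξ Λ Ξᵀ` factorizes
`(I Ǎ_s B̌_{u0} B̌_{w0}) H (I Ǎ_s B̌_{u0} B̌_{w0})ᵀ`. -/
def IsFactorization : Prop :=
  S.Λ.PosDef ∧ S.checkColᵀ * S.H * S.checkCol = S.Ξ * S.Λ * S.Ξᵀ

/-- `Ǎ`. -/
def checkA : Matrix (Fin n) (Fin n) ℝ := S.A S.checkAs

/-- `B̌`. -/
def checkB : Matrix (Fin n) (Fin m) ℝ := S.B S.checkBu

/-- `B̌₁`. -/
def checkB1 : Matrix (Fin n) (Fin mw) ℝ := S.B1 S.checkBw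

/-- `col(H̄₁₂ᵀ, H̄₁₃ᵀ, H̄₁₄ᵀ)`. -/
def HbarT : Matrix (Fin n ⊕ Fin m ⊕ Fin mw) (Fin p) ℝ :=
  (fromCols S.Htopᵀ S.Hlow : Matrix _ (Fin p ⊕ (Fin n ⊕ Fin m ⊕ Fin mw)) ℝ) * S.checkCol

/-- `X_{s1}`, the first `p` rows of `X_s`. -/
def Xs1 : Matrix (Fin p) (Fin n) ℝ := S.Xs.toRows₁

/-- The columns of `L₁ᵀ` (the rows of `L₁`) form a basis of `ker X_{s1}`. -/
def IsKernelBasis : Prop :=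
  LinearIndependent ℝ (fun i => S.L1 i) ∧
    Submodule.span ℝ (Set.range fun i => S.L1 i) = LinearMap.ker S.Xs1.mulVecLin

/-- `L = col(L₁, L₂)` with `L₂ = (X_{s1} X_{s1}ᵀ)⁻¹ X_{s1}`. -/
def L : Matrix (Fin (n - p) ⊕ Fin p) (Fin n) ℝ := fromRows S.L1 ((S.Xs1 * S.Xs1ᵀ)⁻¹ * S.Xs1)

/-- `L^{-ᵀ}`. -/
def LinvT : Matrix (Fin (n - p) ⊕ Fin p) (Fin n) ℝ := (rectInv S.L)ᵀ

/-! ### The synthesis inequalities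

`Π` is written for `Q = -I`, `S = 0` and an empty `R̃` block. -/

variable (v : DecisionVars m pc n)

/-- `Π₁₁`. -/
def Pi11 : Matrix ((Fin n ⊕ Fin n) ⊕ Fin mw) ((Fin n ⊕ Fin n) ⊕ Fin mw) ℝ :=
  fromBlocks (fromBlocks v.Xb 1 1 v.Yb) 0 0 1

/-- `Π₁₂ᵀ`; block rows `n, n, (n, m, mw), q`, block columns `n, n, mw`. -/
def Pi12T : Matrix ((Fin n ⊕ Fin n) ⊕ ((Fin n ⊕ Fin m ⊕ Fin mw) ⊕ Fin q))
    ((Fin n ⊕ Fin n) ⊕ Fin mw) ℝ :=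
  fromRows
    (fromCols
      (fromBlocks
        (S.checkA + S.checkB * v.Dc * S.C) (S.checkA * v.Yb + S.checkB * v.Ct)
        (v.Xb * S.checkA + v.Bt * S.C) v.At)
      (fromRows S.checkB1 (v.Xb * S.checkB1)))
    (fromRows
      (fromRows (fromCols (fromCols 1 v.Yb) 0)
        (fromRows (fromCols (fromCols (v.Dc * S.C) v.Ct) 0) (fromCols 0 1)))
      0)

/-- `(0 M) L^{-ᵀ}` for a matrix `M` with `p` columns. -/
def padL {b : Type} (M : Matrix b (Fin p) ℝ) : Matrix b (Fin n) ℝ :=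
  (fromCols 0 M : Matrix b (Fin (n - p) ⊕ Fin p) ℝ) * S.LinvT

/-- The block rows of `Π₂₂` below its upper left `2n × 2n` corner `(Ȳ I; I X̄)`, restricted to the
columns of that corner. -/
def Pi22low : Matrix ((Fin n ⊕ Fin m ⊕ Fin mw) ⊕ Fin q) (Fin n ⊕ Fin n) ℝ :=
  fromRows
    (fromCols (S.padL (-(v.α • S.HbarT))) (S.padL (-(v.α • S.HbarT)) * v.Xb))
    (fromCols (S.padL (v.α • S.Ξᵀ)) (S.padL (v.α • S.Ξᵀ) * v.Xb))

/-- `Π₂₂`. -/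
def Pi22 : Matrix ((Fin n ⊕ Fin n) ⊕ ((Fin n ⊕ Fin m ⊕ Fin mw) ⊕ Fin q))
    ((Fin n ⊕ Fin n) ⊕ ((Fin n ⊕ Fin m ⊕ Fin mw) ⊕ Fin q)) ℝ :=
  fromBlocks (fromBlocks v.Yb 1 1 v.Xb) (S.Pi22low v)ᵀ (S.Pi22low v)
    (fromBlocks (-(v.α • S.Hlow)) 0 0 (v.α • S.Λ⁻¹))

/-- `Π`. -/
def PiMat : Matrix
    (((Fin n ⊕ Fin n) ⊕ Fin mw) ⊕ ((Fin n ⊕ Fin n) ⊕ ((Fin n ⊕ Fin m ⊕ Fin mw) ⊕ Fin q)))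
    (((Fin n ⊕ Fin n) ⊕ Fin mw) ⊕ ((Fin n ⊕ Fin n) ⊕ ((Fin n ⊕ Fin m ⊕ Fin mw) ⊕ Fin q))) ℝ :=
  fromBlocks (Pi11 v) (S.Pi12T v)ᵀ (S.Pi12T v) (S.Pi22 v)

/-- `Δ`; block rows and columns `mw, pz, n, n`. -/
def DeltaMat (Z : Matrix (Fin pz) (Fin pz) ℝ) :
    Matrix ((Fin mw ⊕ Fin pz) ⊕ (Fin n ⊕ Fin n)) ((Fin mw ⊕ Fin pz) ⊕ (Fin n ⊕ Fin n)) ℝ :=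
  fromBlocks
    (fromBlocks 1 S.D1ᵀ S.D1 Z)
    (fromRows 0 (fromCols (S.C1 + S.E * v.Dc * S.C) (S.C1 * v.Yb + S.E * v.Ct)))
    (fromRows 0 (fromCols (S.C1 + S.E * v.Dc * S.C) (S.C1 * v.Yb + S.E * v.Ct)))ᵀ
    (fromBlocks v.Xb 1 1 v.Yb)

/-- The synthesis inequalities hold for the decision variables `v`. -/
def SynthesisLMI (μ : ℝ) (Z : Matrix (Fin pz) (Fin pz) ℝ) : Prop :=
  v.Xb.IsSymm ∧ v.Yb.IsSymm ∧
    Z.trace < μ ^ 2 ∧ (S.PiMat v).PosDef ∧ (S.DeltaMat v Z).PosDef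

/-! ### Reconstruction of the controller -/

/-- The matrix `U = (I - X̄ Ȳ) V^{-ᵀ}`. -/
def recU (V : Matrix (Fin n) (Fin n) ℝ) : Matrix (Fin n) (Fin n) ℝ := (1 - v.Xb * v.Yb) * Vᵀ⁻¹

/-- `B_c`. -/
def recB (V : Matrix (Fin n) (Fin n) ℝ) : Matrix (Fin n) (Fin pc) ℝ :=
  (recU v V)⁻¹ * (v.Bt - v.Xb * S.checkB * v.Dc)

/-- The controller reconstructed from the decision variables and `V`. -/
def reconstruct (V : Matrix (Fin n) (Fin n) ℝ) : Controller m pc n where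
  Ac := (recU v V)⁻¹ * (v.At - v.Xb * (S.checkA * v.Yb + S.checkB * v.Ct)
    - recU v V * S.recB v V * S.C * v.Yb) * Vᵀ⁻¹
  Bc := S.recB v V
  Cc := (v.Ct - v.Dc * S.C * v.Yb) * Vᵀ⁻¹
  Dc := v.Dc

end Setup

end DataDrivenH2

end

/-! Write `T` for the row of a triple and `Ť` for its central value. Since `-H_∘ ≻ 0` by the rank
condition, completing the square in `(I T) H (I T)ᵀ ⪰ 0` shows that `Σ` is the matrix ellipsoid `T =
Ť + D`, `D (-H_∘) Dᵀ ⪯ Ξ Λ Ξᵀ`. Full column rank of `B_{d0}` and `Φ₂₂ ≺ 0` make this inequality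
equivalent to the existence of an admissible `W_d` (`posSemidef_of_mem_Sigma`,
`mem_Sigma_of_posSemidef`, `col_H_col`).

A Schur complement makes the Lyapunov inequality affine in `(ÃP B̃)`, which is a nominal value plus
`E D M` because a triple enters only through the first `p` rows of the realization. For a fixed
vector `y`, the vectors `Dᵀ Eᵀ y` fill exactly an ellipsoid (`exists_uncertainty`), so robust
definiteness is an implication between two quadratic forms. The strict S-lemma `strict_s_lemma`
replaces it, without loss, by one inequality with a scalar multiplier `α`; this is `multiplierMat`.

The classical linearizing substitution for output feedback is then a congruence turning that
inequality and the output inequality into `Π ≻ 0` and `Δ ≻ 0` (`conj_lyapunovMat`,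
`posDef_outputMat_iff`). It needs an invertible off-diagonal block of `P`, which a small
perturbation of `P` supplies since all inequalities are strict. Conversely, `Δ ≻ 0` makes `I - X̄Ȳ`
invertible, so the substitution can be solved for the controller. -/

namespace DataDrivenH2

/-! ### Quadratic forms and definiteness of block matrices -/

section QuadraticForms

variable {ι κ : Type*} [Fintype ι] [Fintype κ]

/-- The quadratic form `x ↦ xᵀ Q x`. -/
def quad (Q : Matrix ι ι ℝ) (x : ι → ℝ) : ℝ := x ⬝ᵥ Q *ᵥ x

theorem continuous_quad (Q : Matrix ι ι ℝ) : Continuous (quad Q) := by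
  unfold quad
  fun_prop

@[simp] theorem quad_zero_right (Q : Matrix ι ι ℝ) : quad Q 0 = 0 := by simp [quad]

@[simp] theorem quad_zero_left (x : ι → ℝ) : quad (0 : Matrix ι ι ℝ) x = 0 := by simp [quad]

theorem quad_sub (Q R : Matrix ι ι ℝ) (x : ι → ℝ) : quad (Q - R) x = quad Q x - quad R x := by
  simp [quad, sub_mulVec]

theorem quad_neg (Q : Matrix ι ι ℝ) (x : ι → ℝ) : quad (-Q) x = -quad Q x := by
  simp [quad, neg_mulVec]

theorem quad_matrix_smul (c : ℝ) (Q : Matrix ι ι ℝ) (x : ι → ℝ) :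
    quad (c • Q) x = c * quad Q x := by
  simp [quad, smul_mulVec]

theorem quad_smul (Q : Matrix ι ι ℝ) (c : ℝ) (x : ι → ℝ) :
    quad Q (c • x) = c ^ 2 * quad Q x := by
  simp only [quad, mulVec_smul, dotProduct_smul, smul_dotProduct, smul_eq_mul]
  ring

theorem quad_smul_add_smul (Q : Matrix ι ι ℝ) (a b : ℝ) (x y : ι → ℝ) :
    quad Q (a • x + b • y) =
      a ^ 2 * quad Q x + a * b * (x ⬝ᵥ Q *ᵥ y + y ⬝ᵥ Q *ᵥ x) + b ^ 2 * quad Q y := by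
  simp only [quad, mulVec_add, mulVec_smul, dotProduct_add, add_dotProduct, dotProduct_smul,
    smul_dotProduct, smul_eq_mul]
  ring

theorem dotProduct_mulVec_comm (B : Matrix κ ι ℝ) (a : ι → ℝ) (b : κ → ℝ) :
    a ⬝ᵥ Bᵀ *ᵥ b = b ⬝ᵥ B *ᵥ a := by
  rw [dotProduct_mulVec, vecMul_transpose, dotProduct_comm]

theorem quad_add_right {Q : Matrix ι ι ℝ} (hQ : Q.IsSymm) (x y : ι → ℝ) :
    quad Q (x + y) = quad Q x + 2 * (x ⬝ᵥ Q *ᵥ y) + quad Q y := by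
  have h : y ⬝ᵥ Q *ᵥ x = x ⬝ᵥ Q *ᵥ y := by
    rw [← dotProduct_mulVec_comm, hQ.eq]
  simp only [quad, mulVec_add, dotProduct_add, add_dotProduct, h]
  ring

theorem quad_conj (Q : Matrix κ κ ℝ) (T : Matrix κ ι ℝ) (x : ι → ℝ) :
    quad (Tᵀ * Q * T) x = quad Q (T *ᵥ x) := by
  rw [quad, quad, ← mulVec_mulVec, ← mulVec_mulVec, dotProduct_mulVec_comm, dotProduct_comm]

theorem quad_conj_transpose (Q : Matrix κ κ ℝ) (T : Matrix ι κ ℝ) (x : ι → ℝ) :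
    quad (T * Q * Tᵀ) x = quad Q (Tᵀ *ᵥ x) := by
  rw [← quad_conj, transpose_transpose]

theorem posDef_iff_quad {Q : Matrix ι ι ℝ} :
    Q.PosDef ↔ Q.IsSymm ∧ ∀ x, x ≠ 0 → 0 < quad Q x := by
  rw [posDef_iff_dotProduct_mulVec]
  simp only [IsHermitian, conjTranspose_eq_transpose_of_trivial, IsSymm, star_trivial, quad]

theorem posSemidef_iff_quad {Q : Matrix ι ι ℝ} :
    Q.PosSemidef ↔ Q.IsSymm ∧ ∀ x, 0 ≤ quad Q x := by
  rw [posSemidef_iff_dotProduct_mulVec]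
  simp only [IsHermitian, conjTranspose_eq_transpose_of_trivial, IsSymm, star_trivial, quad]

theorem posDef_conj_iff [DecidableEq ι] {Q T : Matrix ι ι ℝ} (hT : IsUnit T) :
    (Tᵀ * Q * T).PosDef ↔ Q.PosDef := by
  simpa [star_eq_conjTranspose] using hT.posDef_star_left_conjugate_iff (x := Q)

theorem quad_fromBlocks (A : Matrix ι ι ℝ) (B : Matrix κ ι ℝ) (D : Matrix κ κ ℝ)
    (a : ι → ℝ) (b : κ → ℝ) :
    quad (fromBlocks A Bᵀ B D) (Sum.elim a b) = quad A a + 2 * (b ⬝ᵥ B *ᵥ a) + quad D b := by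
  simp only [quad, fromBlocks_mulVec, sumElim_dotProduct_sumElim, dotProduct_add,
    Sum.elim_comp_inl, Sum.elim_comp_inr, dotProduct_mulVec_comm]
  ring

theorem quad_fromBlocks_diag (A : Matrix ι ι ℝ) (D : Matrix κ κ ℝ) (a : ι → ℝ) (b : κ → ℝ) :
    quad (fromBlocks A 0 0 D) (Sum.elim a b) = quad A a + quad D b := by
  simpa using quad_fromBlocks A 0 D a b

theorem sumElim_ne_zero_iff {a : ι → ℝ} {b : κ → ℝ} : Sum.elim a b ≠ 0 ↔ a ≠ 0 ∨ b ≠ 0 := by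
  rw [Ne, ← Sum.elim_zero_zero, Sum.elim_eq_iff]
  tauto

theorem posDef_fromBlocks_iff {A : Matrix ι ι ℝ} {B : Matrix κ ι ℝ} {D : Matrix κ κ ℝ} :
    (fromBlocks A Bᵀ B D).PosDef ↔ A.IsSymm ∧ D.IsSymm ∧ ∀ (a : ι → ℝ) (b : κ → ℝ),
      a ≠ 0 ∨ b ≠ 0 → 0 < quad A a + 2 * (b ⬝ᵥ B *ᵥ a) + quad D b := by
  rw [posDef_iff_quad, isSymm_fromBlocks_iff]
  constructor
  · rintro ⟨⟨h1, -, -, h2⟩, h⟩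
    refine ⟨h1, h2, fun a b hab => ?_⟩
    rw [← quad_fromBlocks]
    exact h _ (sumElim_ne_zero_iff.2 hab)
  · rintro ⟨h1, h2, h⟩
    refine ⟨⟨h1, transpose_transpose _, rfl, h2⟩, fun x hx => ?_⟩
    obtain ⟨a, b, rfl⟩ : ∃ a b, x = Sum.elim a b := ⟨_, _, (Sum.elim_comp_inl_inr x).symm⟩
    rw [quad_fromBlocks]
    exact h a b (sumElim_ne_zero_iff.1 hx)

end QuadraticForms

/-! ### The strict S-lemma -/

section SLemma

variable {ι : Type*} [Fintype ι]

/-- Along a segment from `x` to `±y`, the sign chosen so that the cross term of `Q` is nonpositive,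
`Q` stays nonpositive while `R` changes sign and so vanishes somewhere. -/
theorem exists_quad_eq_zero {Q R : Matrix ι ι ℝ} {x y : ι → ℝ} (hx : x ≠ 0) (hy : y ≠ 0)
    (hQx : quad Q x ≤ 0) (hQy : quad Q y ≤ 0) (hRx : 0 ≤ quad R x) (hRy : quad R y ≤ 0) :
    ∃ z, z ≠ 0 ∧ quad Q z ≤ 0 ∧ quad R z = 0 := by
  wlog hc : x ⬝ᵥ Q *ᵥ y + y ⬝ᵥ Q *ᵥ x ≤ 0 generalizing y
  · have hneg (T : Matrix ι ι ℝ) : quad T (-y) = quad T y := by simp [quad, mulVec_neg]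
    refine this (y := -y) (neg_ne_zero.2 hy) (by rwa [hneg]) (by rwa [hneg]) ?_
    simp only [mulVec_neg, dotProduct_neg, neg_dotProduct]
    linarith
  have hcont : ContinuousOn (fun s : ℝ => quad R ((1 - s) • x + s • y)) (Set.Icc 0 1) := by
    refine ((continuous_quad R).comp ?_).continuousOn
    fun_prop
  obtain ⟨s, ⟨hs0, hs1⟩, hs⟩ : (0 : ℝ) ∈
      (fun s : ℝ => quad R ((1 - s) • x + s • y)) '' Set.Icc 0 1 := by
    refine intermediate_value_Icc' zero_le_one hcont ⟨?_, ?_⟩ <;> simpa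
  by_cases hz : (1 - s) • x + s • y = 0
  -- The segment meets the origin only if `y` is a nonzero multiple of `x`; then `R` has the same
  -- sign at both, which forces `quad R x = 0`.
  · refine ⟨x, hx, hQx, le_antisymm ?_ hRx⟩
    have hs_ne : s ≠ 0 := by
      rintro rfl
      simp at hz
      exact hx hz
    have hyx : y = (-((1 - s) / s)) • x := by
      have h1 : s • y = -((1 - s) • x) := by
        rw [eq_neg_iff_add_eq_zero, add_comm]; exact hz
      rw [← inv_smul_smul₀ hs_ne y, h1, smul_neg, smul_smul, ← neg_smul]
      congr 1
      ring
    have hcoef : -((1 - s) / s) ≠ 0 := by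
      intro h
      rw [h, zero_smul] at hyx
      exact hy hyx
    rw [hyx, quad_smul] at hRy
    have : 0 < (-((1 - s) / s)) ^ 2 := by positivity
    nlinarith
  · refine ⟨_, hz, ?_, hs⟩
    rw [quad_smul_add_smul]
    have h1 : 0 ≤ 1 - s := by linarith
    have := mul_nonneg (sq_nonneg (1 - s)) (neg_nonneg.2 hQx)
    have := mul_nonneg (sq_nonneg s) (neg_nonneg.2 hQy)
    have := mul_nonneg (mul_nonneg h1 hs0) (neg_nonneg.2 hc)
    linarith

/-- The strict S-lemma, without a constraint qualification. -/
theorem strict_s_lemma {Q R : Matrix ι ι ℝ}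
    (h : ∀ x, x ≠ 0 → 0 ≤ quad R x → 0 < quad Q x) :
    ∃ α : ℝ, 0 < α ∧ ∀ x, x ≠ 0 → 0 < quad Q x - α * quad R x := by
  by_contra! hcon
  let K : Set (ℝ × (ι → ℝ)) := Set.Icc (0 : ℝ) 1 ×ˢ Metric.sphere 0 1
  have hK : IsCompact K := isCompact_Icc.prod (isCompact_sphere _ _)
  have hclosed (C : Set (ℝ × (ι → ℝ))) (hC : IsClosed C) : IsClosed (Prod.fst '' (K ∩ C)) :=
    ((hK.inter_right hC).image continuous_fst).isClosed
  let T : ℝ × (ι → ℝ) → ℝ := fun z => (1 - z.1) * quad Q z.2 - z.1 * quad R z.2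
  have cQ : Continuous fun z : ℝ × (ι → ℝ) => quad Q z.2 := (continuous_quad Q).comp continuous_snd
  have cR : Continuous fun z : ℝ × (ι → ℝ) => quad R z.2 := (continuous_quad R).comp continuous_snd
  have cT : Continuous T := by
    unfold T
    fun_prop
  have hC : IsClosed {z | T z ≤ 0} := isClosed_le cT continuous_const
  have hCpos : IsClosed {z : ℝ × (ι → ℝ) | T z ≤ 0 ∧ 0 ≤ quad R z.2} :=
    hC.inter (isClosed_le continuous_const cR)
  have hCneg : IsClosed {z : ℝ × (ι → ℝ) | T z ≤ 0 ∧ quad R z.2 ≤ 0 ∧ quad Q z.2 ≤ 0} :=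
    hC.inter ((isClosed_le cR continuous_const).inter (isClosed_le cQ continuous_const))
  -- The substitution `α = t / (1 - t)` compactifies the range of multipliers: failure for every `α
  -- > 0` gives a bad unit vector for each `t` in `(0, 1)`, and compactness extends this to both
  -- endpoints.
  have hbad : Set.Icc (0 : ℝ) 1 ⊆ Prod.fst '' (K ∩ {z | T z ≤ 0}) := by
    rw [← closure_Ioo (zero_ne_one' ℝ)]
    refine closure_minimal ?_ (hclosed _ hC)
    rintro t ⟨ht0, ht1⟩
    have h1t : 0 < 1 - t := by linarith
    obtain ⟨x, hx, hxle⟩ := hcon (t / (1 - t)) (div_pos ht0 h1t)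
    have hnx : 0 < ‖x‖ := norm_pos_iff.2 hx
    refine ⟨(t, ‖x‖⁻¹ • x), ⟨⟨⟨ht0.le, ht1.le⟩, ?_⟩, ?_⟩, rfl⟩
    · simp [norm_smul, hnx.ne']
    · have h2 : (1 - t) * quad Q x - t * quad R x ≤ 0 := by
        have := mul_nonpos_of_nonneg_of_nonpos h1t.le hxle
        have h3 : (1 - t) * (quad Q x - t / (1 - t) * quad R x) =
            (1 - t) * quad Q x - t * quad R x := by
          field_simp
        linarith
      have h4 : T (t, ‖x‖⁻¹ • x) = (‖x‖⁻¹) ^ 2 * ((1 - t) * quad Q x - t * quad R x) := by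
        simp only [T, quad_smul]
        ring
      rw [Set.mem_ofPred_eq, h4]
      exact mul_nonpos_of_nonneg_of_nonpos (sq_nonneg _) h2
  -- A bad vector with `R < 0` also has `Q ≤ 0`, so the parameters split into two closed sets
  -- according to the sign of `R`. Each is nonempty, witnessed by `t = 1` and `t = 0`, so
  -- connectedness yields a common `t`.
  have hcover : Set.Icc (0 : ℝ) 1 ⊆
      Prod.fst '' (K ∩ {z | T z ≤ 0 ∧ 0 ≤ quad R z.2}) ∪
        Prod.fst '' (K ∩ {z | T z ≤ 0 ∧ quad R z.2 ≤ 0 ∧ quad Q z.2 ≤ 0}) := by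
    intro t ht
    obtain ⟨⟨t', x⟩, ⟨hxK, hxT⟩, rfl⟩ := hbad ht
    rcases le_or_gt 0 (quad R x) with hR | hR
    · exact Or.inl ⟨_, ⟨hxK, hxT, hR⟩, rfl⟩
    · refine Or.inr ⟨_, ⟨hxK, hxT, hR.le, ?_⟩, rfl⟩
      by_contra! hQ
      simp only [Set.mem_Icc, Set.mem_ofPred_eq, T] at ht hxT hQ
      have h1 := mul_nonneg (sub_nonneg.2 ht.2) hQ.le
      have h2 := mul_nonneg ht.1 (neg_nonneg.2 hR.le)
      rcases eq_or_lt_of_le ht.1 with h0 | h0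
      · simp only [← h0] at hxT
        linarith
      · nlinarith [mul_pos h0 (neg_pos.2 hR)]
  have hne {x : ι → ℝ} {t : ℝ} (hx : (t, x) ∈ K) : x ≠ 0 := by
    rintro rfl
    simp [K] at hx
  obtain ⟨t, ht, ⟨⟨t₁, x⟩, ⟨hxK, hxT, hxR⟩, rfl⟩, ⟨⟨t₂, y⟩, ⟨hyK, hyT, hyR, hyQ⟩, hty⟩⟩ :=
    isPreconnected_closed_iff.1 (isPreconnected_Icc (a := (0 : ℝ)) (b := 1)) _ _
      (hclosed _ hCpos) (hclosed _ hCneg) hcover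
      (by
        obtain ⟨⟨t', x⟩, ⟨hxK, hxT⟩, h1⟩ := hbad (Set.right_mem_Icc.2 zero_le_one)
        refine ⟨1, Set.right_mem_Icc.2 zero_le_one, ⟨(t', x), ⟨hxK, hxT, ?_⟩, h1⟩⟩
        obtain rfl : t' = 1 := h1
        simpa [T] using hxT)
      (by
        obtain ⟨⟨t', x⟩, ⟨hxK, hxT⟩, h1⟩ := hbad (Set.left_mem_Icc.2 zero_le_one)
        obtain rfl : t' = 0 := h1
        have hQ : quad Q x ≤ 0 := by simpa [T] using hxT
        have hR : quad R x ≤ 0 := by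
          by_contra! hR
          exact (h x (hne hxK) hR.le).not_ge hQ
        exact ⟨0, Set.left_mem_Icc.2 zero_le_one, ⟨(0, x), ⟨hxK, hxT, hR, hQ⟩, rfl⟩⟩)
  obtain rfl : t₂ = t₁ := hty
  rcases eq_or_lt_of_le ht.2 with h1 | h1
  · obtain rfl : t₂ = 1 := h1
    have hR : 0 ≤ quad R y := by simpa [T] using hyT
    exact (h y (hne hyK) hR).not_ge hyQ
  · have hquad (z : ι → ℝ) : quad ((1 - t₂) • Q - t₂ • R) z = T (t₂, z) := by
      simp only [quad_sub, quad_matrix_smul, T]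
    -- At a common `t < 1`, a bad vector with `R = 0` has `Q ≤ 0`, contradicting the hypothesis.
    obtain ⟨z, hz, hzT, hzR⟩ := exists_quad_eq_zero (Q := (1 - t₂) • Q - t₂ • R) (R := R)
      (hne hxK) (hne hyK) ((hquad x).trans_le hxT) ((hquad y).trans_le hyT) hxR hyR
    rw [hquad] at hzT
    simp only [T, hzR, mul_zero, sub_zero] at hzT
    have := mul_pos (sub_pos.2 h1) (h z hz hzR.ge)
    linarith

end SLemma

/-! ### Robust definiteness over a matrix ellipsoid (Petersen's lemma) -/

section Petersen

variable {a b p q r : Type*} [Fintype a] [Fintype b] [Fintype p] [Fintype q] [Fintype r]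

theorem quad_cauchySchwarz {Λ : Matrix q q ℝ} (hΛ : Λ.PosSemidef) {g : q → ℝ}
    (hg : 0 < quad Λ g) (h : q → ℝ) : (h ⬝ᵥ Λ *ᵥ g) ^ 2 ≤ quad Λ h * quad Λ g := by
  obtain ⟨hsymm, hnn⟩ := posSemidef_iff_quad.1 hΛ
  have h1 := hnn (quad Λ g • h + (-(h ⬝ᵥ Λ *ᵥ g)) • g)
  have h2 : g ⬝ᵥ Λ *ᵥ h = h ⬝ᵥ Λ *ᵥ g := by rw [← dotProduct_mulVec_comm, hsymm.eq]
  rw [quad_smul_add_smul, h2] at h1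
  have h3 : 0 ≤ quad Λ g * (quad Λ h * quad Λ g - (h ⬝ᵥ Λ *ᵥ g) ^ 2) := by linarith
  have := nonneg_of_mul_nonneg_right h3 hg
  linarith

/-- A rank one uncertainty `D` inside the ellipsoid `D Γ Dᵀ ⪯ Ξ Λ Ξᵀ` whose transpose maps a
prescribed vector `x` to a prescribed vector `ξ`. -/
theorem exists_uncertainty {Γ : Matrix r r ℝ} {Λ : Matrix q q ℝ} (hΓ : Γ.PosDef) (hΛ : Λ.PosDef)
    (Ξ : Matrix p q ℝ) (x : p → ℝ) (ξ : r → ℝ) (h : quad Γ ξ ≤ quad Λ (Ξᵀ *ᵥ x)) :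
    ∃ D : Matrix p r ℝ, (Ξ * Λ * Ξᵀ - D * Γ * Dᵀ).PosSemidef ∧ Dᵀ *ᵥ x = ξ := by
  have hΓs := (posDef_iff_quad.1 hΓ).1
  have hΛs := (posDef_iff_quad.1 hΛ).1
  have hsymm (D : Matrix p r ℝ) : (Ξ * Λ * Ξᵀ - D * Γ * Dᵀ).IsSymm := by
    simp only [IsSymm, transpose_sub, transpose_mul, transpose_transpose, hΛs.eq, hΓs.eq,
      Matrix.mul_assoc]
  have hquad (D : Matrix p r ℝ) (z : p → ℝ) :
      quad (Ξ * Λ * Ξᵀ - D * Γ * Dᵀ) z = quad Λ (Ξᵀ *ᵥ z) - quad Γ (Dᵀ *ᵥ z) := by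
    rw [quad_sub, quad_conj_transpose, quad_conj_transpose]
  set g := Ξᵀ *ᵥ x with hg
  by_cases hg0 : g = 0
  · have hξ : ξ = 0 := by
      by_contra hξ
      rw [hg0, quad_zero_right] at h
      exact ((posDef_iff_quad.1 hΓ).2 ξ hξ).not_ge h
    refine ⟨0, posSemidef_iff_quad.2 ⟨hsymm 0, fun z => ?_⟩, by simp [hξ]⟩
    rw [hquad]
    simpa using (posSemidef_iff_quad.1 hΛ.posSemidef).2 _
  · have hpos : 0 < quad Λ g := (posDef_iff_quad.1 hΛ).2 g hg0
    have hDT (z : p → ℝ) : ((quad Λ g)⁻¹ • vecMulVec (Ξ *ᵥ (Λ *ᵥ g)) ξ)ᵀ *ᵥ z =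
        ((quad Λ g)⁻¹ * ((Ξᵀ *ᵥ z) ⬝ᵥ Λ *ᵥ g)) • ξ := by
      rw [transpose_smul, transpose_vecMulVec, smul_mulVec, vecMulVec_mulVec, ← smul_smul,
        dotProduct_comm (Ξ *ᵥ _), ← dotProduct_mulVec_comm, dotProduct_comm (Λ *ᵥ g)]
      simp
    -- With `g = Ξᵀ x`, the choice `D = Ξ Λ g ξᵀ / (gᵀ Λ g)` sends `x` to `ξ` under transposition;
    -- membership in the ellipsoid is Cauchy–Schwarz for `Λ`.
    refine ⟨(quad Λ g)⁻¹ • vecMulVec (Ξ *ᵥ (Λ *ᵥ g)) ξ,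
      posSemidef_iff_quad.2 ⟨hsymm _, fun z => ?_⟩, ?_⟩
    · rw [hquad, hDT, quad_smul]
      have h1 := quad_cauchySchwarz hΛ.posSemidef hpos (Ξᵀ *ᵥ z)
      have h2 : ((quad Λ g)⁻¹ * ((Ξᵀ *ᵥ z) ⬝ᵥ Λ *ᵥ g)) ^ 2 * quad Γ ξ ≤
          ((quad Λ g)⁻¹ * ((Ξᵀ *ᵥ z) ⬝ᵥ Λ *ᵥ g)) ^ 2 * quad Λ g := by gcongr
      have h3 : ((quad Λ g)⁻¹ * ((Ξᵀ *ᵥ z) ⬝ᵥ Λ *ᵥ g)) ^ 2 * quad Λ g =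
          ((Ξᵀ *ᵥ z) ⬝ᵥ Λ *ᵥ g) ^ 2 / quad Λ g := by
        field_simp
      have h4 : ((Ξᵀ *ᵥ z) ⬝ᵥ Λ *ᵥ g) ^ 2 / quad Λ g ≤ quad Λ (Ξᵀ *ᵥ z) := by
        rwa [div_le_iff₀ hpos]
      linarith
    · rw [hDT, ← hg]
      change ((quad Λ g)⁻¹ * quad Λ g) • ξ = ξ
      rw [inv_mul_cancel₀ hpos.ne', one_smul]

variable [DecidableEq q]

/-- The block matrix that certifies robust definiteness with the multiplier `α`. -/
noncomputable def multiplierMat (S : Matrix a a ℝ) (G : Matrix b a ℝ) (M : Matrix r a ℝ) (P : Matrix b b ℝ)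
    (F : Matrix b q ℝ) (Γ : Matrix r r ℝ) (Λ : Matrix q q ℝ) (α : ℝ) :
    Matrix (a ⊕ (b ⊕ (r ⊕ q))) (a ⊕ (b ⊕ (r ⊕ q))) ℝ :=
  fromBlocks S (fromRows G (fromRows M 0))ᵀ (fromRows G (fromRows M 0))
    (fromBlocks P (fromRows 0 (α • Fᵀ))ᵀ (fromRows 0 (α • Fᵀ))
      (fromBlocks (α • Γ) 0 0 (α • Λ⁻¹)))

variable {S : Matrix a a ℝ} {G : Matrix b a ℝ} {M : Matrix r a ℝ} {P : Matrix b b ℝ}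
    {F : Matrix b q ℝ} {Γ : Matrix r r ℝ} {Λ : Matrix q q ℝ} {α : ℝ}

/-- Completing the square in `η`: the minimum is `-quad Λ g`, attained at `η = -Λ g`. This is how
the block `α Λ⁻¹` encodes the term `Ξ Λ Ξᵀ`. -/
theorem quad_inv_add (hΛ : Λ.PosDef) (g η : q → ℝ) :
    quad Λ⁻¹ η + 2 * (η ⬝ᵥ g) = quad Λ⁻¹ (η + Λ *ᵥ g) - quad Λ g := by
  have hu := (Matrix.isUnit_iff_isUnit_det _).1 hΛ.isUnit
  have hs := (posDef_iff_quad.1 hΛ).1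
  rw [quad_add_right (posDef_iff_quad.1 hΛ.inv).1, mulVec_mulVec, nonsing_inv_mul _ hu,
    one_mulVec]
  have : quad Λ⁻¹ (Λ *ᵥ g) = quad Λ g := by
    rw [← quad_conj, hs.eq, mul_nonsing_inv _ hu, Matrix.one_mul]
  rw [this]
  ring

theorem quad_multiplierMat (x : a → ℝ) (y : b → ℝ) (ξ : r → ℝ) (η : q → ℝ) :
    quad (multiplierMat S G M P F Γ Λ α) (Sum.elim x (Sum.elim y (Sum.elim ξ η))) =
      quad S x + 2 * (y ⬝ᵥ G *ᵥ x) + 2 * (ξ ⬝ᵥ M *ᵥ x) + quad P y +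
        α * (quad Γ ξ + (quad Λ⁻¹ η + 2 * (η ⬝ᵥ Fᵀ *ᵥ y))) := by
  rw [multiplierMat, quad_fromBlocks, quad_fromBlocks, quad_fromBlocks_diag]
  simp only [fromRows_mulVec, sumElim_dotProduct_sumElim, zero_mulVec, dotProduct_zero,
    smul_mulVec, dotProduct_smul, quad_matrix_smul, smul_eq_mul]
  ring

omit [Fintype a] [Fintype b] [Fintype r] in
theorem isSymm_multiplierMat (hS : S.IsSymm) (hP : P.IsSymm) (hΓ : Γ.IsSymm) (hΛ : Λ⁻¹.IsSymm) :
    (multiplierMat S G M P F Γ Λ α).IsSymm := by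
  refine hS.fromBlocks (transpose_transpose _) (hP.fromBlocks (transpose_transpose _) ?_)
  exact IsSymm.fromBlocks (hΓ.smul α) (transpose_zero) (hΛ.smul α)

/-- No sign of `α` is assumed. If `g ≠ 0`, testing the block `α Λ⁻¹` at `g` gives `α > 0`; if `g =
0`, both forms vanish and the sign is irrelevant. This also covers an empty index type `q`. -/
theorem nonneg_multiplier_mul (h : (multiplierMat S G M P F Γ Λ α).PosDef) (hΓ : Γ.PosDef)
    (hΛ : Λ.PosDef) (ξ : r → ℝ) (g : q → ℝ) (hle : quad Γ ξ ≤ quad Λ g) :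
    0 ≤ α * (quad Λ g - quad Γ ξ) := by
  by_cases hg : g = 0
  · subst hg
    rw [quad_zero_right] at hle ⊢
    have := (posSemidef_iff_quad.1 hΓ.posSemidef).2 ξ
    rw [le_antisymm hle this]
    simp
  · have h1 := (posDef_iff_quad.1 h).2 (Sum.elim 0 (Sum.elim 0 (Sum.elim 0 g))) (by
      simp only [ne_eq, sumElim_ne_zero_iff]
      tauto)
    rw [quad_multiplierMat] at h1
    simp only [quad_zero_right, mulVec_zero, dotProduct_zero, mul_zero, zero_add, add_zero] at h1
    have h2 := (posDef_iff_quad.1 hΛ.inv).2 g hg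
    exact mul_nonneg (pos_of_mul_pos_left h1 h2.le).le (sub_nonneg.2 hle)

/-- Sufficiency of the multiplier certificate. -/
theorem posDef_of_multiplierMat (Ξ : Matrix p q ℝ) (E : Matrix b p ℝ)
    (hΓ : Γ.PosDef) (hΛ : Λ.PosDef)
    (h : (multiplierMat S G M P (E * Ξ) Γ Λ α).PosDef) (D : Matrix p r ℝ)
    (hD : (Ξ * Λ * Ξᵀ - D * Γ * Dᵀ).PosSemidef) :
    (fromBlocks S (G + E * D * M)ᵀ (G + E * D * M) P).PosDef := by
  have hsymm := (posDef_iff_quad.1 h).1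
  rw [multiplierMat, isSymm_fromBlocks_iff, isSymm_fromBlocks_iff] at hsymm
  refine posDef_fromBlocks_iff.2 ⟨hsymm.1, hsymm.2.2.2.1, fun x y hxy => ?_⟩
  have hle := (posSemidef_iff_quad.1 hD).2 (Eᵀ *ᵥ y)
  rw [quad_sub, quad_conj_transpose, quad_conj_transpose, sub_nonneg] at hle
  have h1 := nonneg_multiplier_mul h hΓ hΛ _ _ hle
  -- The third component realizes the uncertainty `D`, and the fourth is the minimizer from
  -- `quad_inv_add`.
  have h2 := (posDef_iff_quad.1 h).2 (Sum.elim x (Sum.elim y (Sum.elim (Dᵀ *ᵥ (Eᵀ *ᵥ y))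
    (-(Λ *ᵥ (Ξᵀ *ᵥ (Eᵀ *ᵥ y))))))) (by
      simp only [ne_eq, sumElim_ne_zero_iff]
      tauto)
  rw [quad_multiplierMat, transpose_mul, ← mulVec_mulVec, quad_inv_add hΛ, neg_add_cancel,
    quad_zero_right] at h2
  have h3 : (Dᵀ *ᵥ (Eᵀ *ᵥ y)) ⬝ᵥ M *ᵥ x = y ⬝ᵥ (E * D * M) *ᵥ x := by
    rw [mulVec_mulVec, ← transpose_mul, dotProduct_comm, dotProduct_mulVec_comm, mulVec_mulVec]
  rw [add_mulVec, dotProduct_add, ← h3]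
  linarith

/-- Necessity of the multiplier certificate. -/
theorem exists_multiplierMat_posDef (Ξ : Matrix p q ℝ) (E : Matrix b p ℝ)
    (hS : S.IsSymm) (hP : P.IsSymm) (hΓ : Γ.PosDef) (hΛ : Λ.PosDef)
    (h : ∀ D : Matrix p r ℝ, (Ξ * Λ * Ξᵀ - D * Γ * Dᵀ).PosSemidef →
      (fromBlocks S (G + E * D * M)ᵀ (G + E * D * M) P).PosDef) :
    ∃ α : ℝ, 0 < α ∧ (multiplierMat S G M P (E * Ξ) Γ Λ α).PosDef := by
  -- The variable `ξ` stands for `Dᵀ Eᵀ y`. `Q₀` is the perturbed form in these variables, and `Q₁ ≥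
  -- 0` says that some admissible `D` produces `ξ`.
  let Q₀ : Matrix (a ⊕ (b ⊕ r)) (a ⊕ (b ⊕ r)) ℝ :=
    fromBlocks S (fromRows G M)ᵀ (fromRows G M) (fromBlocks P 0 0 0)
  let Q₁ : Matrix (a ⊕ (b ⊕ r)) (a ⊕ (b ⊕ r)) ℝ :=
    fromBlocks 0 0 0 (fromBlocks ((E * Ξ) * Λ * (E * Ξ)ᵀ) 0 0 (-Γ))
  have hQ₀ (x : a → ℝ) (y : b → ℝ) (ξ : r → ℝ) :
      quad Q₀ (Sum.elim x (Sum.elim y ξ)) =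
        quad S x + 2 * (y ⬝ᵥ G *ᵥ x) + 2 * (ξ ⬝ᵥ M *ᵥ x) + quad P y := by
    simp only [Q₀, quad_fromBlocks, quad_fromBlocks_diag, fromRows_mulVec,
      sumElim_dotProduct_sumElim, quad_zero_left]
    ring
  have hQ₁ (x : a → ℝ) (y : b → ℝ) (ξ : r → ℝ) :
      quad Q₁ (Sum.elim x (Sum.elim y ξ)) = quad Λ ((E * Ξ)ᵀ *ᵥ y) - quad Γ ξ := by
    simp only [Q₁, quad_fromBlocks_diag, quad_zero_left, quad_neg]
    rw [quad_conj_transpose]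
    ring
  have helim (z : a ⊕ (b ⊕ r) → ℝ) : ∃ x y ξ, z = Sum.elim x (Sum.elim y ξ) :=
    ⟨z ∘ Sum.inl, z ∘ Sum.inr ∘ Sum.inl, z ∘ Sum.inr ∘ Sum.inr, by
      funext i; rcases i with i | i | i <;> rfl⟩
  obtain ⟨α, hα, hpos⟩ := strict_s_lemma (Q := Q₀) (R := Q₁) (by
    intro z hz hz1
    obtain ⟨x, y, ξ, rfl⟩ := helim z
    rw [hQ₁, sub_nonneg] at hz1
    rw [hQ₀]
    obtain ⟨D, hD, hDξ⟩ := exists_uncertainty hΓ hΛ Ξ (Eᵀ *ᵥ y) ξ (by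
      rwa [mulVec_mulVec, ← transpose_mul])
    -- If `x` and `y` both vanished, `ξ = Dᵀ Eᵀ y` would vanish too.
    have hxy : x ≠ 0 ∨ y ≠ 0 := by
      by_contra! hxy
      obtain ⟨rfl, rfl⟩ := hxy
      rw [mulVec_zero, mulVec_zero] at hDξ
      subst hDξ
      simp at hz
    have h2 := (posDef_fromBlocks_iff.1 (h D hD)).2.2 x y hxy
    have h3 : ξ ⬝ᵥ M *ᵥ x = y ⬝ᵥ (E * D * M) *ᵥ x := by
      rw [← hDξ, mulVec_mulVec, ← transpose_mul, dotProduct_comm, dotProduct_mulVec_comm,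
        mulVec_mulVec]
    rw [add_mulVec, dotProduct_add, ← h3] at h2
    linarith)
  refine ⟨α, hα, posDef_iff_quad.2 ⟨isSymm_multiplierMat hS hP (posDef_iff_quad.1 hΓ).1
    (posDef_iff_quad.1 hΛ.inv).1, fun z hz => ?_⟩⟩
  obtain ⟨x, y, ξ, η, rfl⟩ : ∃ x y ξ η, z = Sum.elim x (Sum.elim y (Sum.elim ξ η)) :=
    ⟨z ∘ Sum.inl, z ∘ Sum.inr ∘ Sum.inl, z ∘ Sum.inr ∘ Sum.inr ∘ Sum.inl,
      z ∘ Sum.inr ∘ Sum.inr ∘ Sum.inr, by funext i; rcases i with i | i | i | i <;> rfl⟩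
  rw [quad_multiplierMat, quad_inv_add hΛ]
  by_cases h0 : x = 0 ∧ y = 0 ∧ ξ = 0
  · obtain ⟨rfl, rfl, rfl⟩ := h0
    have hη : η ≠ 0 := by
      rintro rfl
      simp at hz
    simpa using mul_pos hα ((posDef_iff_quad.1 hΛ.inv).2 η hη)
  · have h1 := hpos (Sum.elim x (Sum.elim y ξ)) (by
      simp only [ne_eq, sumElim_ne_zero_iff]
      tauto)
    rw [hQ₀, hQ₁] at h1
    have h2 := mul_nonneg hα.le ((posSemidef_iff_quad.1 hΛ.inv.posSemidef).2
      (η + Λ *ᵥ ((E * Ξ)ᵀ *ᵥ y)))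
    linarith

end Petersen

/-! ### Schur complements for the Lyapunov and output inequalities -/

section SchurComplements

variable {s w z : Type*} [Fintype s] [Fintype w] [Fintype z] [DecidableEq w]

/-- The two forms differ by the square `quad P (x + Aᵀ y)`, which vanishes at `x = -Aᵀ y`. On the
right `A` and `B` enter affinely, as the multiplier certificate requires. -/
theorem posDef_lyapunov_iff {P : Matrix s s ℝ} (hP : P.PosDef) (A : Matrix s s ℝ)
    (B : Matrix s w ℝ) :
    (fromBlocks (1 : Matrix w w ℝ) Bᵀ B (P - A * P * Aᵀ)).PosDef ↔
      (fromBlocks (fromBlocks P 0 0 (1 : Matrix w w ℝ)) (fromCols (A * P) B)ᵀ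
        (fromCols (A * P) B) P).PosDef := by
  have hPs := (posDef_iff_quad.1 hP).1
  have hkey (x : s → ℝ) (d : w → ℝ) (y : s → ℝ) :
      quad (fromBlocks P 0 0 (1 : Matrix w w ℝ)) (Sum.elim x d) +
        2 * (y ⬝ᵥ fromCols (A * P) B *ᵥ Sum.elim x d) + quad P y =
      quad P (x + Aᵀ *ᵥ y) +
        (quad (1 : Matrix w w ℝ) d + 2 * (y ⬝ᵥ B *ᵥ d) + quad (P - A * P * Aᵀ) y) := by
    have h1 : quad (A * P * Aᵀ) y = quad P (Aᵀ *ᵥ y) := quad_conj_transpose P A y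
    have h2 : y ⬝ᵥ (A * P) *ᵥ x = x ⬝ᵥ P *ᵥ (Aᵀ *ᵥ y) := by
      rw [mulVec_mulVec, ← dotProduct_mulVec_comm, transpose_mul, hPs.eq]
    rw [quad_fromBlocks_diag, fromCols_mulVec_sumElim, dotProduct_add, quad_sub,
      quad_add_right hPs, h1, h2]
    ring
  rw [posDef_fromBlocks_iff, posDef_fromBlocks_iff]
  constructor
  · rintro ⟨-, -, h⟩
    refine ⟨hPs.fromBlocks transpose_zero transpose_one, hPs, fun c y hcy => ?_⟩
    obtain ⟨x, d, rfl⟩ : ∃ x d, c = Sum.elim x d := ⟨_, _, (Sum.elim_comp_inl_inr c).symm⟩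
    rw [hkey]
    by_cases hdy : d ≠ 0 ∨ y ≠ 0
    · have := (posSemidef_iff_quad.1 hP.posSemidef).2 (x + Aᵀ *ᵥ y)
      linarith [h d y hdy]
    · push Not at hdy
      obtain ⟨rfl, rfl⟩ := hdy
      have hx : x ≠ 0 := by
        rintro rfl
        simp at hcy
      simpa using (posDef_iff_quad.1 hP).2 x hx
  · rintro ⟨-, -, h⟩
    refine ⟨transpose_one, ?_, fun d y hdy => ?_⟩
    · simp only [IsSymm, transpose_sub, transpose_mul, transpose_transpose, hPs.eq,
        Matrix.mul_assoc]
    · have := h (Sum.elim (-(Aᵀ *ᵥ y)) d) y (by rw [sumElim_ne_zero_iff]; tauto)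
      rw [hkey] at this
      simpa using this

/-- Here the extra square is that of `d + Dᵀ ζ`, which absorbs `D Dᵀ` into the identity block. -/
theorem posDef_output_iff {P : Matrix s s ℝ} (hP : P.IsSymm) (Z : Matrix z z ℝ)
    (C : Matrix z s ℝ) (D : Matrix z w ℝ) :
    (fromBlocks (Z - D * Dᵀ) (C * P) (P * Cᵀ) P).PosDef ↔
      (fromBlocks (fromBlocks (1 : Matrix w w ℝ) Dᵀ D Z) (fromRows 0 (C * P))
        (fromRows 0 (C * P))ᵀ P).PosDef := by
  have hC : C * P = (P * Cᵀ)ᵀ := by rw [transpose_mul, transpose_transpose, hP.eq]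
  have hkey (d : w → ℝ) (ζ : z → ℝ) (y : s → ℝ) :
      quad (fromBlocks (1 : Matrix w w ℝ) Dᵀ D Z) (Sum.elim d ζ) +
        2 * (y ⬝ᵥ (fromRows 0 (C * P))ᵀ *ᵥ Sum.elim d ζ) + quad P y =
      quad (1 : Matrix w w ℝ) (d + Dᵀ *ᵥ ζ) +
        (quad (Z - D * Dᵀ) ζ + 2 * (y ⬝ᵥ (P * Cᵀ) *ᵥ ζ) + quad P y) := by
    have h1 : quad (D * Dᵀ) ζ = quad (1 : Matrix w w ℝ) (Dᵀ *ᵥ ζ) := by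
      rw [← quad_conj, transpose_transpose, Matrix.mul_one]
    rw [quad_fromBlocks, quad_add_right isSymm_one, quad_sub, h1, one_mulVec,
      dotProduct_mulVec_comm D, dotProduct_mulVec_comm (fromRows 0 (C * P)), fromRows_mulVec,
      sumElim_dotProduct_sumElim, zero_mulVec, dotProduct_zero, hC, dotProduct_mulVec_comm (P * Cᵀ)]
    ring
  have hnn (d : w → ℝ) : 0 ≤ quad (1 : Matrix w w ℝ) d :=
    (posSemidef_iff_quad.1 PosSemidef.one).2 d
  -- Double transposes bring the blocks into the shape `Bᵀ`, `B` expected by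
  -- `posDef_fromBlocks_iff`.
  rw [← transpose_transpose (fromRows 0 (C * P)), transpose_transpose (fromRows 0 (C * P))ᵀ,
    posDef_fromBlocks_iff, hC, posDef_fromBlocks_iff, ← hC]
  constructor
  · rintro ⟨hZ, -, h⟩
    have hDD : (D * Dᵀ).IsSymm := by
      rw [IsSymm, transpose_mul, transpose_transpose]
    have hZs : Z.IsSymm := by simpa using hZ.add hDD
    refine ⟨isSymm_one.fromBlocks (transpose_transpose _) hZs, hP, fun c y hcy => ?_⟩
    obtain ⟨d, ζ, rfl⟩ : ∃ d ζ, c = Sum.elim d ζ := ⟨_, _, (Sum.elim_comp_inl_inr c).symm⟩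
    rw [hkey]
    by_cases hζy : ζ ≠ 0 ∨ y ≠ 0
    · linarith [h ζ y hζy, hnn (d + Dᵀ *ᵥ ζ)]
    · push Not at hζy
      obtain ⟨rfl, rfl⟩ := hζy
      have hd : d ≠ 0 := by
        rintro rfl
        simp at hcy
      simpa using (posDef_iff_quad.1 (PosDef.one (n := w) (R := ℝ))).2 d hd
  · rintro ⟨hZ, -, h⟩
    refine ⟨?_, hP, fun ζ y hζy => ?_⟩
    · rw [isSymm_fromBlocks_iff] at hZ
      simp only [IsSymm, transpose_sub, transpose_mul, transpose_transpose, hZ.2.2.2.eq]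
    · have := h (Sum.elim (-(Dᵀ *ᵥ ζ)) ζ) y (by rw [sumElim_ne_zero_iff]; tauto)
      rw [hkey] at this
      simpa using this

end SchurComplements

/-! ### Stability of definiteness and generic invertibility -/

section Perturbation

variable {ι : Type*} [Fintype ι]

/-- Positivity on the compact unit sphere is an open condition in `ε`, and homogeneity extends it to
all nonzero vectors. -/
theorem eventually_posDef {f : ℝ → Matrix ι ι ℝ} (hf : Continuous f) (hs : ∀ ε, (f ε).IsSymm)
    (h0 : (f 0).PosDef) : ∀ᶠ ε in nhds 0, (f ε).PosDef := by
  have hcont : Continuous fun z : ℝ × (ι → ℝ) => quad (f z.1) z.2 := by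
    unfold quad
    fun_prop
  have h1 : ∀ᶠ ε in nhds (0 : ℝ), ∀ x ∈ Metric.sphere (0 : ι → ℝ) 1, 0 < quad (f ε) x := by
    refine (isCompact_sphere _ _).eventually_forall_of_forall_eventually fun x hx => ?_
    refine hcont.continuousAt.eventually (lt_mem_nhds ?_)
    refine (posDef_iff_quad.1 h0).2 x ?_
    rintro rfl
    simp at hx
  filter_upwards [h1] with ε hε
  refine posDef_iff_quad.2 ⟨hs ε, fun x hx => ?_⟩
  have hn : 0 < ‖x‖ := norm_pos_iff.2 hx
  have h2 := hε (‖x‖⁻¹ • x) (by simp [norm_smul, hn.ne'])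
  rw [quad_smul] at h2
  exact pos_of_mul_pos_right h2 (sq_nonneg _)

/-- Singularity occurs only for `ε` in the finite spectrum of `-V`. -/
theorem frequently_isUnit_add_smul_one [DecidableEq ι] (V : Matrix ι ι ℝ) :
    ∃ᶠ ε in nhds (0 : ℝ), IsUnit (V + ε • (1 : Matrix ι ι ℝ)) := by
  have h1 : ∀ᶠ ε in nhdsWithin (0 : ℝ) {0}ᶜ, IsUnit (V + ε • (1 : Matrix ι ι ℝ)) := by
    have hfin := (Matrix.finite_spectrum (-V)).subset
      (Set.sdiff_subset : spectrum ℝ (-V) \ {0} ⊆ spectrum ℝ (-V))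
    have hmem : (spectrum ℝ (-V) \ {0})ᶜ ∈ nhds (0 : ℝ) :=
      hfin.isClosed.isOpen_compl.mem_nhds (by simp)
    filter_upwards [nhdsWithin_le_nhds hmem, self_mem_nhdsWithin] with ε hε hε0
    have : ε ∉ spectrum ℝ (-V) := fun h => hε ⟨h, hε0⟩
    rw [spectrum.notMem_iff] at this
    rwa [sub_neg_eq_add, Algebra.algebraMap_eq_smul_one, add_comm] at this
  exact h1.frequently.filter_mono nhdsWithin_le_nhds

end Perturbation

/-! ### Consequences of full row rank -/

section Rank

variable {ι κ : Type*} [Fintype ι] [Fintype κ]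

theorem linearIndependent_row_of_rank_eq {M : Matrix ι κ ℝ} (h : M.rank = Fintype.card ι) :
    LinearIndependent ℝ M.row := by
  rw [linearIndependent_iff_card_eq_finrank_span, ← h, rank_eq_finrank_span_row, Set.finrank]

theorem posDef_mul_mul_transpose {Q : Matrix κ κ ℝ} (hQ : Q.PosDef) {M : Matrix ι κ ℝ}
    (hM : LinearIndependent ℝ M.row) : (M * Q * Mᵀ).PosDef := by
  simpa using hQ.mul_mul_conjTranspose_same (B := M) (vecMul_injective_iff.2 hM)

theorem isUnit_mul_transpose_self [DecidableEq ι] {M : Matrix ι κ ℝ}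
    (hM : LinearIndependent ℝ M.row) : IsUnit (M * Mᵀ).det := by
  classical
  have := (posDef_mul_mul_transpose (PosDef.one (n := κ) (R := ℝ)) hM).isUnit
  rw [Matrix.mul_one] at this
  exact (isUnit_iff_isUnit_det _).1 this

theorem isUnit_of_rank_eq [DecidableEq ι] {V : Matrix ι ι ℝ} (h : V.rank = Fintype.card ι) :
    IsUnit V :=
  linearIndependent_rows_iff_isUnit.1 (linearIndependent_row_of_rank_eq h)

end Rank

namespace Setup

variable {k p m mw md N pz pc n q : ℕ} (S : Setup k p m mw md N pz pc n q)

/-! ### The consistent triples as a matrix ellipsoid -/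

section DataSet

theorem isSymm_H (hΦ : S.Φ.IsSymm) : S.H.IsSymm := by
  simp only [IsSymm, H, transpose_mul, transpose_transpose, hΦ.eq, Matrix.mul_assoc]

/-- The zero block of `Hfac` leaves only `Φ₂₂` here, conjugated by the regressor, which has full row
rank. -/
theorem posDef_neg_Hlow (hΦ22 : (-S.Φ.toBlocks₂₂).PosDef)
    (hrank : S.regressor.rank = n + m + mw) : (-S.Hlow).PosDef := by
  have h : -S.Hlow = S.regressor * (-S.Φ.toBlocks₂₂) * S.regressorᵀ := by
    rw [Hlow, H, Hfac, ← fromBlocks_toBlocks S.Φ, fromBlocks_transpose, fromBlocks_multiply,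
      fromBlocks_multiply]
    simp
  rw [h]
  refine posDef_mul_mul_transpose hΦ22 (linearIndependent_row_of_rank_eq ?_)
  simp [hrank, add_assoc]

variable {S}

theorem Hlow_mul_checkT (hΓ : (-S.Hlow).PosDef) : S.Hlow * S.checkT = -S.Htopᵀ := by
  have hu : IsUnit S.Hlow.det := by
    have := hΓ.isUnit.neg
    rw [neg_neg] at this
    exact (isUnit_iff_isUnit_det _).1 this
  rw [checkT, Matrix.mul_neg, mul_nonsing_inv_cancel_left _ _ hu]

/-- The central triple is the stationary point of the quadratic, so the linear term vanishes and the
`h̄` blocks of `Π` are zero. -/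
theorem HbarT_eq_zero (hΓ : (-S.Hlow).PosDef) : S.HbarT = 0 := by
  rw [HbarT, checkCol, fromCols_mul_fromRows, Hlow_mul_checkT hΓ]
  simp

/-- The block row `(I T)`. -/
def paramRow (T : Matrix (Fin p) (Fin n ⊕ Fin m ⊕ Fin mw) ℝ) :
    Matrix (Fin p) (Fin p ⊕ (Fin n ⊕ Fin m ⊕ Fin mw)) ℝ :=
  fromCols 1 T

/-- Completing the square in the quadratic matrix inequality that describes `Σ`. -/
theorem col_H_col (hΦ : S.Φ.IsSymm) (hΓ : (-S.Hlow).PosDef) (hfact : S.IsFactorization)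
    (T : Matrix (Fin p) (Fin n ⊕ Fin m ⊕ Fin mw) ℝ) :
    paramRow T * S.H * (paramRow T)ᵀ =
      S.Ξ * S.Λ * S.Ξᵀ - (T - S.checkTᵀ) * (-S.Hlow) * (T - S.checkTᵀ)ᵀ := by
  have hsymm := S.isSymm_H hΦ
  have hH : S.H = fromBlocks S.H.toBlocks₁₁ S.Htop S.Htopᵀ S.Hlow := by
    conv_lhs => rw [← fromBlocks_toBlocks S.H]
    congr 1
    conv_lhs => rw [← hsymm.eq]
    rfl
  have hlow : S.Hlowᵀ = S.Hlow := by
    have := (posDef_iff_quad.1 hΓ).1.eq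
    rw [transpose_neg] at this
    exact neg_injective this
  have h1 : S.Htopᵀ = -(S.Hlow * S.checkT) := by rw [Hlow_mul_checkT hΓ, neg_neg]
  have h2 : S.Htop = -(S.checkTᵀ * S.Hlow) := by
    rw [← transpose_transpose S.Htop, h1, transpose_neg, transpose_mul, hlow]
  rw [← hfact.2, checkCol, hH, h1, h2]
  simp only [paramRow, transpose_fromCols, transpose_fromRows, fromCols_mul_fromBlocks,
    fromCols_mul_fromRows, transpose_one, Matrix.mul_one, Matrix.one_mul, transpose_sub,
    transpose_transpose, Matrix.mul_neg, Matrix.neg_mul, Matrix.mul_sub, Matrix.sub_mul,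
    Matrix.add_mul, Matrix.mul_assoc]
  abel

theorem col_mul_Hfac (T : Matrix (Fin p) (Fin n ⊕ Fin m ⊕ Fin mw) ℝ) :
    paramRow T * S.Hfac = fromCols S.Bd0 (S.Y - T * S.regressor) := by
  rw [Hfac, paramRow, fromCols_mul_fromBlocks]
  simp [sub_eq_add_neg]

theorem fromCols_mul_regressor (As : Matrix (Fin p) (Fin n) ℝ) (Bu : Matrix (Fin p) (Fin m) ℝ)
    (Bw : Matrix (Fin p) (Fin mw) ℝ) :
    fromCols As (fromCols Bu Bw) * S.regressor = As * S.Xd + Bu * S.U + Bw * S.W := by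
  rw [regressor, fromCols_mul_fromRows, fromCols_mul_fromRows, add_assoc]

/-- The residual equals `B_{d0} W_d`, so this is the noise bound conjugated by `B_{d0}`. -/
theorem posSemidef_of_mem_Sigma {As : Matrix (Fin p) (Fin n) ℝ} {Bu : Matrix (Fin p) (Fin m) ℝ}
    {Bw : Matrix (Fin p) (Fin mw) ℝ} (h : (As, Bu, Bw) ∈ S.Sigma) :
    (paramRow (fromCols As (fromCols Bu Bw)) * S.H *
      (paramRow (fromCols As (fromCols Bu Bw)))ᵀ).PosSemidef := by
  obtain ⟨Wd, hWd, hY⟩ := h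
  have h1 : paramRow (fromCols As (fromCols Bu Bw)) * S.Hfac = S.Bd0 * (noiseCol Wd)ᵀ := by
    rw [col_mul_Hfac, fromCols_mul_regressor, noiseCol, transpose_fromRows, mul_fromCols, hY]
    simp
  have h2 := hWd.mul_mul_conjTranspose_same S.Bd0
  rw [conjTranspose_eq_transpose_of_trivial] at h2
  convert h2 using 1
  have h3 := congrArg transpose h1
  rw [transpose_mul, transpose_mul S.Bd0, transpose_transpose] at h3
  rw [H]
  simp only [Matrix.mul_assoc] at h3 ⊢
  rw [h3, ← Matrix.mul_assoc (paramRow _), h1]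
  simp only [Matrix.mul_assoc]

/-- The inequality forces the residual `E` into the column space of `B_{d0}`; the least-squares
solution is then an exact `W_d`. -/
theorem mem_Sigma_of_posSemidef (hBd0 : S.Bd0.rank = md) (hΦ : S.Φ.IsSymm)
    (hΦ22 : (-S.Φ.toBlocks₂₂).PosDef)
    {As : Matrix (Fin p) (Fin n) ℝ} {Bu : Matrix (Fin p) (Fin m) ℝ}
    {Bw : Matrix (Fin p) (Fin mw) ℝ}
    (h : (paramRow (fromCols As (fromCols Bu Bw)) * S.H *
      (paramRow (fromCols As (fromCols Bu Bw)))ᵀ).PosSemidef) :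
    (As, Bu, Bw) ∈ S.Sigma := by
  set T := fromCols As (fromCols Bu Bw)
  set E := S.Y - T * S.regressor with hE
  have hfac : paramRow T * S.H * (paramRow T)ᵀ =
      fromCols S.Bd0 E * S.Φ * (fromCols S.Bd0 E)ᵀ := by
    rw [← col_mul_Hfac, H, transpose_mul]
    simp only [Matrix.mul_assoc]
  rw [hfac] at h
  have hu : IsUnit (S.Bd0ᵀ * S.Bd0).det := by
    have := isUnit_mul_transpose_self (M := S.Bd0ᵀ)
      (linearIndependent_row_of_rank_eq (by rw [rank_transpose, hBd0, Fintype.card_fin]))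
    rwa [transpose_transpose] at this
  set R := (S.Bd0ᵀ * S.Bd0)⁻¹ with hR
  have hRs : Rᵀ = R := by rw [hR, transpose_nonsing_inv, transpose_mul, transpose_transpose]
  -- On the kernel of `B_{d0}ᵀ` only the `Φ₂₂` part of the form survives; it is negative unless `Eᵀ
  -- x = 0`.
  have hker (x : Fin p → ℝ) (hx : S.Bd0ᵀ *ᵥ x = 0) : Eᵀ *ᵥ x = 0 := by
    by_contra hne
    have h1 := (posSemidef_iff_quad.1 h).2 x
    rw [quad_conj_transpose, transpose_fromCols, fromRows_mulVec, hx,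
      ← fromBlocks_toBlocks S.Φ] at h1
    have h2 := (posDef_iff_quad.1 hΦ22).2 _ hne
    rw [quad_neg] at h2
    have h3 : quad (fromBlocks S.Φ.toBlocks₁₁ S.Φ.toBlocks₁₂ S.Φ.toBlocks₂₁ S.Φ.toBlocks₂₂)
        (Sum.elim 0 (Eᵀ *ᵥ x)) = quad S.Φ.toBlocks₂₂ (Eᵀ *ᵥ x) := by
      simp [quad, fromBlocks_mulVec, sumElim_dotProduct_sumElim]
    linarith
  have hEW : E = S.Bd0 * (R * S.Bd0ᵀ * E) := by
    have h1 : Eᵀ * (1 - S.Bd0 * R * S.Bd0ᵀ) = 0 := by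
      refine ext_of_mulVec_single fun i => ?_
      rw [← mulVec_mulVec, zero_mulVec]
      apply hker
      rw [mulVec_mulVec, Matrix.mul_sub, Matrix.mul_one, ← Matrix.mul_assoc, ← Matrix.mul_assoc,
        mul_nonsing_inv _ hu, Matrix.one_mul, sub_self, zero_mulVec]
    have h2 := congrArg transpose h1
    rw [transpose_mul, transpose_transpose, transpose_sub, transpose_mul, transpose_mul, hRs,
      transpose_transpose, transpose_one, transpose_zero, Matrix.sub_mul, Matrix.one_mul,
      sub_eq_zero] at h2
    simpa only [Matrix.mul_assoc] using h2
  have hfac2 : fromCols S.Bd0 E = S.Bd0 * (noiseCol (R * S.Bd0ᵀ * E))ᵀ := by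
    rw [noiseCol, transpose_fromRows, mul_fromCols, transpose_one, Matrix.mul_one,
      transpose_transpose, ← hEW]
  refine ⟨R * S.Bd0ᵀ * E, posSemidef_iff_quad.2 ⟨?_, fun x => ?_⟩, ?_⟩
  · simp only [IsSymm, transpose_mul, transpose_transpose, hΦ.eq, Matrix.mul_assoc]
  -- This test vector is a preimage of `x` under `B_{d0}ᵀ`, so the conjugation by `B_{d0}` can be
  -- undone.
  · have h1 := (posSemidef_iff_quad.1 h).2 (S.Bd0 *ᵥ (R *ᵥ x))
    rw [quad_conj_transpose, hfac2, transpose_mul, transpose_transpose, ← mulVec_mulVec,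
      mulVec_mulVec _ S.Bd0ᵀ, mulVec_mulVec, mulVec_mulVec,
      mul_nonsing_inv_cancel_right _ _ hu] at h1
    rwa [quad_conj]
  · change S.Y = As * S.Xd + Bu * S.U + Bw * S.W + S.Bd0 * _
    rw [← hEW, hE, fromCols_mul_regressor]
    abel

end DataSet

/-! ### Elimination of the matrix `L` -/

section KernelBasis

variable {S}

theorem linearIndependent_Xs1 (hSVD : S.IsCompactSVD)
    (hrows : LinearIndependent ℝ (fun i : Fin p => S.X (Sum.inl i))) :
    LinearIndependent ℝ S.Xs1.row := by
  rw [← vecMul_injective_iff]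
  have h : (S.Xs1 * S.Xd).row = fun i : Fin p => S.X (Sum.inl i) := by
    funext i
    rw [hSVD.1, Matrix.mul_assoc]
    rfl
  rw [← h, ← vecMul_injective_iff] at hrows
  intro x y hxy
  refine hrows ?_
  simp only [← vecMul_vecMul] at hxy ⊢
  exact congrArg (fun z => z ᵥ* S.Xd) hxy

/-- The rows of `L₁` are orthogonal to those of `X_{s1}`, so `L X_{s1}ᵀ = col(0, I)`. It remains
that `L` is injective, since `rectInv` is then a left inverse. -/
theorem rectInv_L_mul (hSVD : S.IsCompactSVD)
    (hrows : LinearIndependent ℝ (fun i : Fin p => S.X (Sum.inl i)))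
    (hker : S.IsKernelBasis) : rectInv S.L * (fromRows 0 1 : Matrix (Fin (n - p) ⊕ Fin p) (Fin p) ℝ) = S.Xs1ᵀ := by
  have hu := isUnit_mul_transpose_self (linearIndependent_Xs1 hSVD hrows)
  have hL1 : S.L1 * S.Xs1ᵀ = 0 := by
    have h1 (i : Fin (n - p)) : S.Xs1 *ᵥ S.L1 i = 0 := by
      have : S.L1 i ∈ LinearMap.ker S.Xs1.mulVecLin := by
        rw [← hker.2]
        exact Submodule.subset_span ⟨i, rfl⟩
      simpa using this
    ext i j
    exact (dotProduct_comm _ _).trans (congrFun (h1 i) j)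
  have hinj (x : Fin n → ℝ) (hx : S.L *ᵥ x = 0) : x = 0 := by
    rw [L, fromRows_mulVec, ← Sum.elim_zero_zero, Sum.elim_eq_iff] at hx
    obtain ⟨hx1, hx2⟩ := hx
    have hx3 : S.Xs1 *ᵥ x = 0 := by
      have := congrArg (fun z => (S.Xs1 * S.Xs1ᵀ) *ᵥ z) hx2
      simpa [mulVec_mulVec, ← Matrix.mul_assoc, mul_nonsing_inv _ hu] using this
    have hspan : x ∈ Submodule.span ℝ (Set.range fun i => S.L1 i) := by
      rw [hker.2]
      simpa using hx3
    have horth : ∀ z ∈ Submodule.span ℝ (Set.range fun i => S.L1 i), z ⬝ᵥ x = 0 := by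
      intro z hz
      induction hz using Submodule.span_induction with
      | mem z hz =>
        obtain ⟨i, rfl⟩ := hz
        exact congrFun hx1 i
      | zero => simp
      | add a b _ _ ha hb => rw [add_dotProduct, ha, hb, add_zero]
      | smul c a _ ha => rw [smul_dotProduct, ha, smul_zero]
    -- A vector killed by `L` lies in the span of the rows of `L₁` and is orthogonal to it.
    exact dotProduct_self_eq_zero.1 (horth x hspan)
  have hrow : LinearIndependent ℝ S.Lᵀ.row := by
    rw [row_transpose, ← mulVec_injective_iff]
    intro x y hxy
    rw [← sub_eq_zero]
    apply hinj
    rw [mulVec_sub, sub_eq_zero]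
    exact hxy
  have hLu := isUnit_mul_transpose_self hrow
  rw [transpose_transpose] at hLu
  have hLX : S.L * S.Xs1ᵀ = (fromRows 0 1 : Matrix (Fin (n - p) ⊕ Fin p) (Fin p) ℝ) := by
    rw [L, fromRows_mul, hL1, Matrix.mul_assoc, nonsing_inv_mul _ hu]
  rw [← hLX, rectInv, Matrix.mul_assoc, ← Matrix.mul_assoc S.Lᵀ,
    nonsing_inv_mul_cancel_left _ _ hLu]

theorem padL_eq (hSVD : S.IsCompactSVD)
    (hrows : LinearIndependent ℝ (fun i : Fin p => S.X (Sum.inl i)))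
    (hker : S.IsKernelBasis) {b : Type} (M : Matrix b (Fin p) ℝ) : S.padL M = M * S.Xs1 := by
  have h := congrArg transpose (rectInv_L_mul hSVD hrows hker)
  rw [transpose_transpose] at h
  rw [padL, LinvT, ← h, transpose_mul, ← Matrix.mul_assoc, transpose_fromRows, mul_fromCols]
  simp

end KernelBasis

end Setup

/-- A congruence that fixes the multiplier coordinates preserves the certificate's shape, so the
linearization can be checked block by block. -/
theorem transpose_mul_multiplierMat_mul {a b r q : Type*} [Fintype a] [Fintype b] [Fintype r]
    [Fintype q] [DecidableEq r] [DecidableEq q]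
    (S : Matrix a a ℝ) (G : Matrix b a ℝ) (M : Matrix r a ℝ) (P : Matrix b b ℝ)
    (F : Matrix b q ℝ) (Γ : Matrix r r ℝ) (Λ : Matrix q q ℝ) (α : ℝ)
    (T₁ : Matrix a a ℝ) (T₂ : Matrix b b ℝ) :
    (fromBlocks T₁ 0 0 (fromBlocks T₂ 0 0 (1 : Matrix (r ⊕ q) (r ⊕ q) ℝ)))ᵀ *
        multiplierMat S G M P F Γ Λ α *
        fromBlocks T₁ 0 0 (fromBlocks T₂ 0 0 (1 : Matrix (r ⊕ q) (r ⊕ q) ℝ)) =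
      multiplierMat (T₁ᵀ * S * T₁) (T₂ᵀ * G * T₁) (M * T₁) (T₂ᵀ * P * T₂) (T₂ᵀ * F) Γ Λ α := by
  simp only [multiplierMat, fromBlocks_transpose, fromBlocks_multiply, transpose_zero,
    transpose_one, Matrix.zero_mul, Matrix.mul_zero, add_zero, zero_add, Matrix.one_mul,
    Matrix.mul_one, transpose_fromRows, fromBlocks_mul_fromRows, fromRows_mul,
    mul_fromCols, fromCols_mul_fromBlocks, transpose_mul, transpose_smul, transpose_transpose,
    Matrix.smul_mul, Matrix.mul_smul, Matrix.mul_assoc]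

namespace Setup

variable {k p m mw md N pz pc n q : ℕ} (S : Setup k p m mw md N pz pc n q)

/-! ### Affine dependence of the closed loop on the triple, and robust certificates -/

section ClosedLoop

/-- The input matrix through which the uncertainty enters the closed loop. -/
def uncIn : Matrix (Fin n ⊕ Fin n) (Fin p) ℝ := fromRows S.Xs1ᵀ 0

/-- The matrix by which the closed-loop state enters the uncertainty. -/
def uncOut (K : Controller m pc n) : Matrix (Fin n ⊕ Fin m ⊕ Fin mw) (Fin n ⊕ Fin n) ℝ :=
  fromRows (fromCols 1 0) (fromRows (fromCols (K.Dc * S.C) K.Cc) 0)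

/-- The matrix by which the performance input enters the uncertainty. -/
def uncThrough (n m mw : ℕ) : Matrix (Fin n ⊕ Fin m ⊕ Fin mw) (Fin mw) ℝ := fromRows 0 (fromRows 0 1)

/-- The certificate of the robust Lyapunov inequality in closed-loop coordinates. -/
noncomputable def lyapunovMat (K : Controller m pc n) (P : Matrix (Fin n ⊕ Fin n) (Fin n ⊕ Fin n) ℝ) (α : ℝ) :
    Matrix (((Fin n ⊕ Fin n) ⊕ Fin mw) ⊕ ((Fin n ⊕ Fin n) ⊕ ((Fin n ⊕ Fin m ⊕ Fin mw) ⊕ Fin q)))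
      (((Fin n ⊕ Fin n) ⊕ Fin mw) ⊕ ((Fin n ⊕ Fin n) ⊕ ((Fin n ⊕ Fin m ⊕ Fin mw) ⊕ Fin q))) ℝ :=
  multiplierMat (fromBlocks P 0 0 1)
    (fromCols (S.clA K S.checkAs S.checkBu * P) (S.clB S.checkBw))
    (fromCols (S.uncOut K * P) (uncThrough n m mw)) P (S.uncIn * S.Ξ) (-S.Hlow) S.Λ α

/-- The linearized output inequality in closed-loop coordinates. -/
def outputMat (K : Controller m pc n) (P : Matrix (Fin n ⊕ Fin n) (Fin n ⊕ Fin n) ℝ)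
    (Z : Matrix (Fin pz) (Fin pz) ℝ) :
    Matrix ((Fin mw ⊕ Fin pz) ⊕ (Fin n ⊕ Fin n)) ((Fin mw ⊕ Fin pz) ⊕ (Fin n ⊕ Fin n)) ℝ :=
  fromBlocks (fromBlocks 1 S.D1ᵀ S.D1 Z) (fromRows 0 (S.clC K * P)) (fromRows 0 (S.clC K * P))ᵀ P

theorem checkT_transpose : S.checkTᵀ = fromCols S.checkAs (fromCols S.checkBu S.checkBw) := by
  rw [checkAs, checkBu, checkBw, ← transpose_fromRows, fromRows_toRows, ← transpose_fromRows,
    fromRows_toRows]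

theorem Xs_transpose_mul_fromRows {κ : Type*} (M : Matrix (Fin p) κ ℝ)
    (R : Matrix (RestIdx k p m mw) κ ℝ) :
    S.Xsᵀ * fromRows M R = S.Xs1ᵀ * M + S.Xs.toRows₂ᵀ * R := by
  conv_lhs => rw [← fromRows_toRows S.Xs]
  rw [transpose_fromRows, fromCols_mul_fromRows, Xs1]

/-- Only the first `p` rows of the stacked matrix depend on the triple; the shift rows cancel in the
difference. -/
theorem A_eq (As As' : Matrix (Fin p) (Fin n) ℝ) :
    S.A As = S.A As' + S.Xs1ᵀ * (As - As') := by
  rw [A, A, Xs_transpose_mul_fromRows, Xs_transpose_mul_fromRows, Matrix.mul_sub]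
  abel

theorem B_eq (Bu Bu' : Matrix (Fin p) (Fin m) ℝ) :
    S.B Bu = S.B Bu' + S.Xs1ᵀ * (Bu - Bu') := by
  have h (M : Matrix (Fin p) (Fin m) ℝ) : S.B M = S.Xs1ᵀ * M + S.Xs.toRows₂ᵀ * JB :=
    S.Xs_transpose_mul_fromRows M JB
  rw [h, h, Matrix.mul_sub]
  abel

theorem B1_eq (Bw Bw' : Matrix (Fin p) (Fin mw) ℝ) :
    S.B1 Bw = S.B1 Bw' + S.Xs1ᵀ * (Bw - Bw') := by
  have h (M : Matrix (Fin p) (Fin mw) ℝ) : S.B1 M = S.Xs1ᵀ * M + S.Xs.toRows₂ᵀ * JB1 :=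
    S.Xs_transpose_mul_fromRows M JB1
  rw [h, h, Matrix.mul_sub]
  abel

theorem clA_eq (K : Controller m pc n) (As : Matrix (Fin p) (Fin n) ℝ)
    (Bu : Matrix (Fin p) (Fin m) ℝ) (Bw : Matrix (Fin p) (Fin mw) ℝ) :
    S.clA K As Bu = S.clA K S.checkAs S.checkBu +
      S.uncIn * (fromCols As (fromCols Bu Bw) - S.checkTᵀ) * S.uncOut K := by
  have h : fromCols As (fromCols Bu Bw) - S.checkTᵀ =
      fromCols (As - S.checkAs) (fromCols (Bu - S.checkBu) (Bw - S.checkBw)) := by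
    rw [checkT_transpose]
    ext i (j | j | j) <;> rfl
  rw [h, Matrix.mul_assoc, uncOut, fromCols_mul_fromRows, fromCols_mul_fromRows, mul_fromCols,
    mul_fromCols, uncIn]
  rw [clA, clA, S.A_eq As S.checkAs, S.B_eq Bu S.checkBu]
  ext (i | i) (j | j) <;>
    simp [fromRows_mul, Matrix.mul_add, Matrix.add_mul, Matrix.mul_assoc]
  ring

theorem clB_eq (As : Matrix (Fin p) (Fin n) ℝ)
    (Bu : Matrix (Fin p) (Fin m) ℝ) (Bw : Matrix (Fin p) (Fin mw) ℝ) :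
    S.clB Bw = S.clB S.checkBw +
      S.uncIn * (fromCols As (fromCols Bu Bw) - S.checkTᵀ) * uncThrough n m mw := by
  rw [checkT_transpose, Matrix.mul_assoc, Matrix.sub_mul, uncThrough]
  simp only [fromCols_mul_fromRows, Matrix.mul_zero, Matrix.mul_one, zero_add, uncIn,
    fromRows_mul, clB, S.B1_eq Bw S.checkBw, Matrix.zero_mul, Matrix.mul_sub]
  ext (i | i) j <;> simp

theorem fromCols_cl_eq (K : Controller m pc n) (P : Matrix (Fin n ⊕ Fin n) (Fin n ⊕ Fin n) ℝ)
    (As : Matrix (Fin p) (Fin n) ℝ) (Bu : Matrix (Fin p) (Fin m) ℝ)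
    (Bw : Matrix (Fin p) (Fin mw) ℝ) :
    fromCols (S.clA K As Bu * P) (S.clB Bw) =
      fromCols (S.clA K S.checkAs S.checkBu * P) (S.clB S.checkBw) +
        S.uncIn * (fromCols As (fromCols Bu Bw) - S.checkTᵀ) *
          fromCols (S.uncOut K * P) (uncThrough n m mw) := by
  rw [S.clA_eq K As Bu Bw, S.clB_eq As Bu Bw, mul_fromCols, Matrix.add_mul, Matrix.mul_assoc _ _ P]
  ext i (j | j) <;> rfl

variable {S}

theorem posDef_of_outputMat {K : Controller m pc n} {P : Matrix (Fin n ⊕ Fin n) (Fin n ⊕ Fin n) ℝ}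
    {Z : Matrix (Fin pz) (Fin pz) ℝ} (h : (S.outputMat K P Z).PosDef) : P.PosDef :=
  h.submatrix Sum.inr_injective

/-- A robust closed loop is certified by the matrices `lyapunovMat` and `outputMat`. -/
theorem exists_certificate_of_H2Robust (hBd0 : S.Bd0.rank = md) (hΦ : S.Φ.IsSymm)
    (hΦ22 : (-S.Φ.toBlocks₂₂).PosDef) (hSigma : S.Sigma.Nonempty)
    (hrank : S.regressor.rank = n + m + mw) (hfact : S.IsFactorization)
    {μ : ℝ} {Z : Matrix (Fin pz) (Fin pz) ℝ} {K : Controller m pc n}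
    {P : Matrix (Fin n ⊕ Fin n) (Fin n ⊕ Fin n) ℝ} (h : S.H2Robust μ Z K P) :
    Z.trace < μ ^ 2 ∧ (S.outputMat K P Z).PosDef ∧ ∃ α : ℝ, (S.lyapunovMat K P α).PosDef := by
  have hΓ := S.posDef_neg_Hlow hΦ22 hrank
  -- The trace bound and the output inequality do not involve the triple, so one member of `Σ`
  -- yields them together with `P ≻ 0`.
  obtain ⟨⟨As₀, Bu₀, Bw₀⟩, h₀⟩ := hSigma
  obtain ⟨hZ, -, hout⟩ := h As₀ Bu₀ Bw₀ h₀
  have hP : P.PosDef := hout.submatrix Sum.inr_injective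
  have hPs := (posDef_iff_quad.1 hP).1
  refine ⟨hZ, (posDef_output_iff hPs Z _ _).1 hout, ?_⟩
  obtain ⟨α, -, hα⟩ := exists_multiplierMat_posDef (S := fromBlocks P 0 0 (1 : Matrix (Fin mw) _ ℝ))
    (G := fromCols (S.clA K S.checkAs S.checkBu * P) (S.clB S.checkBw))
    (M := fromCols (S.uncOut K * P) (uncThrough n m mw)) (P := P) S.Ξ S.uncIn
    (hPs.fromBlocks transpose_zero transpose_one) hPs hΓ hfact.1 (by
      intro D hD
      obtain ⟨As, Bu, Bw, hT⟩ : ∃ As Bu Bw, D + S.checkTᵀ = fromCols As (fromCols Bu Bw) :=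
        ⟨_, _, _, by rw [fromCols_toCols, fromCols_toCols]⟩
      have hD' : D = fromCols As (fromCols Bu Bw) - S.checkTᵀ := by rw [← hT, add_sub_cancel_right]
      have hmem : (As, Bu, Bw) ∈ S.Sigma := by
        refine mem_Sigma_of_posSemidef hBd0 hΦ hΦ22 ?_
        rwa [col_H_col hΦ hΓ hfact, ← hD']
      rw [hD', ← S.fromCols_cl_eq]
      exact (posDef_lyapunov_iff hP _ _).1 (h As Bu Bw hmem).2.1)
  exact ⟨α, hα⟩

theorem H2Robust_of_certificate (hΦ : S.Φ.IsSymm) (hΦ22 : (-S.Φ.toBlocks₂₂).PosDef)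
    (hrank : S.regressor.rank = n + m + mw) (hfact : S.IsFactorization)
    {μ α : ℝ} {Z : Matrix (Fin pz) (Fin pz) ℝ} {K : Controller m pc n}
    {P : Matrix (Fin n ⊕ Fin n) (Fin n ⊕ Fin n) ℝ} (hZ : Z.trace < μ ^ 2)
    (hout : (S.outputMat K P Z).PosDef) (hlyap : (S.lyapunovMat K P α).PosDef) :
    S.H2Robust μ Z K P := by
  have hΓ := S.posDef_neg_Hlow hΦ22 hrank
  have hP := posDef_of_outputMat hout
  have hPs := (posDef_iff_quad.1 hP).1
  intro As Bu Bw hT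
  refine ⟨hZ, (posDef_lyapunov_iff hP _ _).2 ?_, (posDef_output_iff hPs Z _ _).2 hout⟩
  rw [S.fromCols_cl_eq]
  refine posDef_of_multiplierMat S.Ξ S.uncIn hΓ hfact.1 hlyap _ ?_
  rw [← col_H_col hΦ hΓ hfact]
  exact posSemidef_of_mem_Sigma hT

/-- The certificates persist under a small perturbation that makes the off-diagonal block of `P`
invertible. -/
theorem exists_certificate_isUnit (hΓ : (-S.Hlow).PosDef) (hfact : S.IsFactorization)
    {Z : Matrix (Fin pz) (Fin pz) ℝ} {K : Controller m pc n}
    {P : Matrix (Fin n ⊕ Fin n) (Fin n ⊕ Fin n) ℝ} {α : ℝ}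
    (hout : (S.outputMat K P Z).PosDef) (hlyap : (S.lyapunovMat K P α).PosDef) :
    ∃ P' : Matrix (Fin n ⊕ Fin n) (Fin n ⊕ Fin n) ℝ, IsUnit P'.toBlocks₁₂ ∧
      (S.outputMat K P' Z).PosDef ∧ (S.lyapunovMat K P' α).PosDef := by
  -- Adding `ε J` keeps `P` symmetric and shifts its off-diagonal block by `ε I`.
  let J : Matrix (Fin n ⊕ Fin n) (Fin n ⊕ Fin n) ℝ := fromBlocks 0 1 1 0
  have hPs := (posDef_iff_quad.1 (posDef_of_outputMat hout)).1
  have hs (ε : ℝ) : (P + ε • J).IsSymm :=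
    hPs.add (IsSymm.smul (isSymm_zero.fromBlocks transpose_one isSymm_zero) ε)
  have hZs : (fromBlocks 1 S.D1ᵀ S.D1 Z).IsSymm := by
    have := (posDef_iff_quad.1 hout).1
    rw [outputMat, isSymm_fromBlocks_iff] at this
    exact this.1
  have hcontP : Continuous fun ε : ℝ => P + ε • J := by fun_prop
  have hrows {a b c : Type} {f : ℝ → Matrix a c ℝ} {g : ℝ → Matrix b c ℝ} (hf : Continuous f)
      (hg : Continuous g) : Continuous fun ε => fromRows (f ε) (g ε) := by
    refine continuous_matrix fun i j => ?_
    rcases i with i | i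
    · exact hf.matrix_elem i j
    · exact hg.matrix_elem i j
  have hcols {a b c : Type} {f : ℝ → Matrix c a ℝ} {g : ℝ → Matrix c b ℝ} (hf : Continuous f)
      (hg : Continuous g) : Continuous fun ε => fromCols (f ε) (g ε) := by
    refine continuous_matrix fun i j => ?_
    rcases j with j | j
    · exact hf.matrix_elem i j
    · exact hg.matrix_elem i j
  have h1 : ∀ᶠ ε in nhds (0 : ℝ), (S.outputMat K (P + ε • J) Z).PosDef := by
    refine eventually_posDef ?_ (fun ε => ?_) (by simpa using hout)
    · have : Continuous fun ε : ℝ =>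
          (fromRows 0 (S.clC K * (P + ε • J)) : Matrix (Fin mw ⊕ Fin pz) (Fin n ⊕ Fin n) ℝ) :=
        hrows continuous_const (continuous_const.matrix_mul hcontP)
      exact continuous_const.matrix_fromBlocks this this.matrix_transpose hcontP
    · exact hZs.fromBlocks rfl (hs ε)
  have h2 : ∀ᶠ ε in nhds (0 : ℝ), (S.lyapunovMat K (P + ε • J) α).PosDef := by
    refine eventually_posDef ?_ (fun ε => ?_) (by simpa using hlyap)
    · have hG : Continuous fun ε : ℝ =>
          (fromRows (fromCols (S.clA K S.checkAs S.checkBu * (P + ε • J)) (S.clB S.checkBw))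
            (fromRows (fromCols (S.uncOut K * (P + ε • J)) (uncThrough n m mw)) 0) :
            Matrix ((Fin n ⊕ Fin n) ⊕ ((Fin n ⊕ Fin m ⊕ Fin mw) ⊕ Fin q))
              ((Fin n ⊕ Fin n) ⊕ Fin mw) ℝ) :=
        hrows (hcols (continuous_const.matrix_mul hcontP) continuous_const)
          (hrows (hcols (continuous_const.matrix_mul hcontP) continuous_const) continuous_const)
      exact (hcontP.matrix_fromBlocks continuous_const continuous_const
        continuous_const).matrix_fromBlocks hG.matrix_transpose hG
        (hcontP.matrix_fromBlocks continuous_const continuous_const continuous_const)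
    · exact isSymm_multiplierMat ((hs ε).fromBlocks transpose_zero transpose_one) (hs ε)
        (posDef_iff_quad.1 hΓ).1 (posDef_iff_quad.1 hfact.1.inv).1
  obtain ⟨ε, hε, hε1, hε2⟩ := ((frequently_isUnit_add_smul_one P.toBlocks₁₂).and_eventually
    (h1.and h2)).exists
  refine ⟨P + ε • J, ?_, hε1, hε2⟩
  convert hε using 1
  ext i j
  simp [J, toBlocks₁₂]

end ClosedLoop

end Setup

namespace Setup

variable {k p m mw md N pz pc n q : ℕ} {S : Setup k p m mw md N pz pc n q}

/-! ### The linearizing change of variables -/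

section Linearization

variable {v : DecisionVars m pc n} {K : Controller m pc n}
  {P : Matrix (Fin n ⊕ Fin n) (Fin n ⊕ Fin n) ℝ} {U V : Matrix (Fin n) (Fin n) ℝ}

variable (S v K P U V) in
/-- The linearizing change of variables between a controller with Lyapunov matrix `P` and the
decision variables of the synthesis inequalities. -/
structure IsLinearization : Prop where
  symm_Xb : v.Xb.IsSymm
  mul_eq : P * fromBlocks v.Xb 1 Uᵀ 0 = fromBlocks 1 v.Yb 0 Vᵀ
  add_eq : v.Xb * v.Yb + U * Vᵀ = 1
  isUnit : IsUnit U
  Dc_eq : v.Dc = K.Dc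
  Ct_eq : v.Ct = K.Dc * S.C * v.Yb + K.Cc * Vᵀ
  Bt_eq : v.Bt = v.Xb * S.checkB * K.Dc + U * K.Bc
  At_eq : v.At = v.Xb * (S.checkA * v.Yb + S.checkB * v.Ct) + U * K.Bc * S.C * v.Yb
    + U * K.Ac * Vᵀ

/-- With `h̄ = 0` and `(0 M) L^{-ᵀ} = M X_{s1}`, the matrix `Π` has exactly the shape of a
multiplier certificate. -/
theorem PiMat_eq (hSVD : S.IsCompactSVD)
    (hrows : LinearIndependent ℝ (fun i : Fin p => S.X (Sum.inl i)))
    (hker : S.IsKernelBasis) (hΓ : (-S.Hlow).PosDef) (hXb : v.Xb.IsSymm) :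
    S.PiMat v = multiplierMat (Pi11 v)
      (fromCols
        (fromBlocks
          (S.checkA + S.checkB * v.Dc * S.C) (S.checkA * v.Yb + S.checkB * v.Ct)
          (v.Xb * S.checkA + v.Bt * S.C) v.At)
        (fromRows S.checkB1 (v.Xb * S.checkB1)))
      (fromRows (fromCols (fromCols 1 v.Yb) 0)
        (fromRows (fromCols (fromCols (v.Dc * S.C) v.Ct) 0) (fromCols 0 1)))
      (fromBlocks v.Yb 1 1 v.Xb)
      (fromRows (S.Xs1ᵀ * S.Ξ) (v.Xb * (S.Xs1ᵀ * S.Ξ))) (-S.Hlow) S.Λ v.α := by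
  have h : S.Pi22low v =
      fromRows 0 (v.α • (fromRows (S.Xs1ᵀ * S.Ξ) (v.Xb * (S.Xs1ᵀ * S.Ξ)))ᵀ) := by
    rw [Pi22low, padL_eq hSVD hrows hker, padL_eq hSVD hrows hker, HbarT_eq_zero hΓ]
    simp only [smul_zero, neg_zero, Matrix.zero_mul, fromCols_zero, transpose_fromRows,
      transpose_mul, transpose_transpose, hXb.eq, Matrix.smul_mul]
    congr 1
    ext i (j | j) <;> simp
  rw [PiMat, Pi22, h, multiplierMat, smul_neg]
  rfl

/-- Swapping the block columns gives a block triangular matrix with diagonal `1`, `Uᵀ`. -/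
theorem isUnit_fromBlocks_swap (X : Matrix (Fin n) (Fin n) ℝ) :
    IsUnit (fromBlocks X (1 : Matrix (Fin n) (Fin n) ℝ) Uᵀ 0) ↔ IsUnit U := by
  have hJ : IsUnit (fromBlocks 0 1 1 0 : Matrix (Fin n ⊕ Fin n) (Fin n ⊕ Fin n) ℝ) := by
    refine IsUnit.of_mul_eq_one (fromBlocks 0 1 1 0) ?_
    simp [fromBlocks_multiply]
  have h : fromBlocks X (1 : Matrix (Fin n) (Fin n) ℝ) Uᵀ 0 =
      fromBlocks 1 X 0 Uᵀ * fromBlocks 0 1 1 0 := by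
    simp [fromBlocks_multiply]
  rw [h, IsUnit.mul_right_iff hJ, isUnit_fromBlocks_zero₂₁, isUnit_transpose]
  simp

/-- By `mul_eq`, `P` disappears: the main block becomes `(1 0; X̄ U) Ã (1 Ȳ; 0 Vᵀ)`, whose products
of controller and certificate entries are the new variables. The second factor has its block columns
swapped, matching the order `Ȳ`, `X̄` in `Π₂₂`. -/
theorem IsLinearization.conj_lyapunovMat (hl : IsLinearization S v K P U V)
    (hSVD : S.IsCompactSVD)
    (hrows : LinearIndependent ℝ (fun i : Fin p => S.X (Sum.inl i)))
    (hker : S.IsKernelBasis) (hΓ : (-S.Hlow).PosDef) :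
    (fromBlocks (fromBlocks (fromBlocks v.Xb 1 Uᵀ 0) 0 0 1) 0 0
        (fromBlocks (fromBlocks 1 v.Xb 0 Uᵀ) 0 0 1))ᵀ * S.lyapunovMat K P v.α *
      fromBlocks (fromBlocks (fromBlocks v.Xb 1 Uᵀ 0) 0 0 1) 0 0
        (fromBlocks (fromBlocks 1 v.Xb 0 Uᵀ) 0 0 1) = S.PiMat v := by
  have hX := hl.symm_Xb.eq
  have hPW : P * fromBlocks 1 v.Xb 0 Uᵀ = fromBlocks v.Yb 1 Vᵀ 0 := by
    have h1 : fromBlocks 1 v.Xb 0 Uᵀ =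
        fromBlocks v.Xb 1 Uᵀ 0 *
          (fromBlocks 0 1 1 0 : Matrix (Fin n ⊕ Fin n) (Fin n ⊕ Fin n) ℝ) := by
      simp [fromBlocks_multiply]
    rw [h1, ← Matrix.mul_assoc, hl.mul_eq]
    simp [fromBlocks_multiply]
  rw [PiMat_eq hSVD hrows hker hΓ hl.symm_Xb, lyapunovMat, transpose_mul_multiplierMat_mul]
  congr 1
  · rw [Pi11, fromBlocks_transpose, fromBlocks_multiply, fromBlocks_multiply]
    simp only [transpose_zero, transpose_one, Matrix.zero_mul, Matrix.mul_zero, add_zero,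
      zero_add, Matrix.one_mul]
    rw [Matrix.mul_assoc, hl.mul_eq, fromBlocks_transpose, fromBlocks_multiply]
    simp [hX, hl.add_eq]
  · rw [mul_fromCols, fromCols_mul_fromBlocks]
    simp only [Matrix.mul_zero, add_zero, zero_add, Matrix.mul_one, ← Matrix.mul_assoc]
    rw [Matrix.mul_assoc _ P, hl.mul_eq]
    congr 1
    · rw [clA, fromBlocks_transpose, fromBlocks_multiply, fromBlocks_multiply, hl.At_eq, hl.Bt_eq,
        hl.Ct_eq, hl.Dc_eq, hX]
      simp only [checkA, checkB, transpose_zero, transpose_one, transpose_transpose,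
        Matrix.zero_mul, Matrix.mul_zero, Matrix.one_mul, Matrix.mul_one, add_zero,
        Matrix.mul_add, Matrix.add_mul, Matrix.mul_assoc]
      congr 1 <;> abel
    · rw [clB, fromBlocks_transpose, fromBlocks_mul_fromRows]
      simp [hX, checkB1]
  · rw [fromCols_mul_fromBlocks, Matrix.mul_assoc, hl.mul_eq]
    simp only [uncOut, uncThrough, fromRows_mul, fromCols_mul_fromBlocks, hl.Dc_eq, hl.Ct_eq]
    ext (i | i | i) ((j | j) | j) <;> simp
  · rw [Matrix.mul_assoc, hPW, fromBlocks_transpose, fromBlocks_multiply]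
    simp [hX, hl.add_eq]
  · rw [uncIn, fromRows_mul, fromBlocks_transpose, fromBlocks_mul_fromRows]
    simp [hX]

theorem IsLinearization.posDef_lyapunovMat_iff (hl : IsLinearization S v K P U V)
    (hSVD : S.IsCompactSVD)
    (hrows : LinearIndependent ℝ (fun i : Fin p => S.X (Sum.inl i)))
    (hker : S.IsKernelBasis) (hΓ : (-S.Hlow).PosDef) :
    (S.PiMat v).PosDef ↔ (S.lyapunovMat K P v.α).PosDef := by
  rw [← hl.conj_lyapunovMat hSVD hrows hker hΓ]
  refine posDef_conj_iff ?_
  simp only [isUnit_fromBlocks_zero₂₁, isUnit_fromBlocks_swap, isUnit_transpose, isUnit_one,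
    hl.isUnit, and_self]

theorem IsLinearization.posDef_outputMat_iff (hl : IsLinearization S v K P U V)
    (Z : Matrix (Fin pz) (Fin pz) ℝ) :
    (S.DeltaMat v Z).PosDef ↔ (S.outputMat K P Z).PosDef := by
  have hX := hl.symm_Xb.eq
  have hC : S.clC K * P * fromBlocks v.Xb 1 Uᵀ 0 =
      fromCols (S.C1 + S.E * v.Dc * S.C) (S.C1 * v.Yb + S.E * v.Ct) := by
    rw [Matrix.mul_assoc, hl.mul_eq, clC, fromCols_mul_fromBlocks, hl.Dc_eq, hl.Ct_eq]
    simp [Matrix.mul_add, Matrix.add_mul, Matrix.mul_assoc, add_assoc]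
  have h : (fromBlocks (1 : Matrix (Fin mw ⊕ Fin pz) _ ℝ) 0 0 (fromBlocks v.Xb 1 Uᵀ 0))ᵀ *
      S.outputMat K P Z * fromBlocks 1 0 0 (fromBlocks v.Xb 1 Uᵀ 0) = S.DeltaMat v Z := by
    rw [outputMat, DeltaMat, fromBlocks_transpose, fromBlocks_multiply, fromBlocks_multiply]
    simp only [transpose_zero, transpose_one, Matrix.zero_mul, Matrix.mul_zero, add_zero,
      zero_add, Matrix.one_mul, Matrix.mul_one]
    congr 1
    · rw [fromRows_mul, Matrix.zero_mul, hC]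
    · rw [← transpose_mul, fromRows_mul, Matrix.zero_mul, hC]
    · rw [Matrix.mul_assoc, hl.mul_eq, fromBlocks_transpose, fromBlocks_multiply]
      simp [hX, hl.add_eq]
  rw [← h]
  refine posDef_conj_iff ?_
  simp only [isUnit_fromBlocks_zero₂₁, isUnit_fromBlocks_swap, isUnit_one, hl.isUnit, and_self]

/-- Every controller with an invertible off-diagonal block in `P` admits linearizing variables. -/
theorem exists_isLinearization (hP : P.PosDef) (hV : IsUnit P.toBlocks₁₂)
    (K : Controller m pc n) (α : ℝ) :
    ∃ (v : DecisionVars m pc n) (U : Matrix (Fin n) (Fin n) ℝ),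
      IsLinearization S v K P U P.toBlocks₁₂ ∧ v.Yb.IsSymm ∧ v.α = α := by
  have hPs := (posDef_iff_quad.1 hP).1
  have hPu := (isUnit_iff_isUnit_det _).1 hP.isUnit
  have hQs : P⁻¹ᵀ = P⁻¹ := by rw [transpose_nonsing_inv, hPs.eq]
  set V := P.toBlocks₁₂ with hVdef
  set Y := P.toBlocks₁₁ with hY
  set X := P⁻¹.toBlocks₁₁ with hX
  set U := P⁻¹.toBlocks₁₂ with hU
  have hQ : P⁻¹ = fromBlocks X U Uᵀ P⁻¹.toBlocks₂₂ := by
    conv_lhs => rw [← fromBlocks_toBlocks P⁻¹]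
    congr 1
    conv_lhs => rw [← hQs]
    rfl
  have hPb : P = fromBlocks Y V Vᵀ P.toBlocks₂₂ := by
    conv_lhs => rw [← fromBlocks_toBlocks P]
    congr 1
    conv_lhs => rw [← hPs.eq]
    rfl
  have hQP : fromBlocks X U Uᵀ P⁻¹.toBlocks₂₂ * fromBlocks Y V Vᵀ P.toBlocks₂₂ =
      fromBlocks 1 0 0 1 := by
    rw [← hQ, ← hPb, nonsing_inv_mul _ hPu, fromBlocks_one]
  -- With `X̄` and `U` the first block row of `P⁻¹`, the first block column of `P⁻¹ P = 1` supplies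
  -- both `X̄Ȳ + U Vᵀ = 1` and the identity behind `mul_eq`.
  rw [fromBlocks_multiply, fromBlocks_inj] at hQP
  have hXs : X.IsSymm := by
    have := (isSymm_fromBlocks_iff.1 (hQ ▸ hQs : (fromBlocks X U Uᵀ P⁻¹.toBlocks₂₂).IsSymm))
    exact this.1
  have hYs : Y.IsSymm := by
    have := (isSymm_fromBlocks_iff.1 (hPb ▸ hPs : (fromBlocks Y V Vᵀ P.toBlocks₂₂).IsSymm))
    exact this.1
  have hXY : P⁻¹ * fromBlocks 1 Y 0 Vᵀ = fromBlocks X 1 Uᵀ 0 := by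
    conv_lhs => rw [hQ]
    rw [fromBlocks_multiply, hQP.1, hQP.2.2.1]
    simp
  have hYu : IsUnit (fromBlocks 1 Y 0 Vᵀ) :=
    isUnit_fromBlocks_zero₂₁.2 ⟨isUnit_one, (isUnit_transpose _).2 hV⟩
  have hUu : IsUnit U := by
    rw [← isUnit_fromBlocks_swap X, ← hXY]
    exact ((isUnit_nonsing_inv_iff).2 hP.isUnit).mul hYu
  let Ct := K.Dc * S.C * Y + K.Cc * Vᵀ
  refine ⟨⟨α, X, Y, X * (S.checkA * Y + S.checkB * Ct) + U * K.Bc * S.C * Y + U * K.Ac * Vᵀ,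
    X * S.checkB * K.Dc + U * K.Bc, Ct, K.Dc⟩, U, ⟨hXs, ?_, hQP.1, hUu, rfl, rfl, rfl, rfl⟩,
    hYs, rfl⟩
  rw [← hXY, mul_nonsing_inv_cancel_left _ _ hPu]

/-- A kernel vector `x` of `1 - X̄Ȳ` would give the kernel vector `(Ȳx, -x)` of the positive
definite corner `(X̄ I; I Ȳ)` of `Δ`. -/
theorem isUnit_one_sub_mul {Z : Matrix (Fin pz) (Fin pz) ℝ} (hΔ : (S.DeltaMat v Z).PosDef) :
    IsUnit (1 - v.Xb * v.Yb) := by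
  have hpos : (fromBlocks v.Xb 1 1 v.Yb).PosDef := hΔ.submatrix Sum.inr_injective
  rw [← mulVec_injective_iff_isUnit]
  refine (injective_iff_map_eq_zero (1 - v.Xb * v.Yb).mulVecLin).2 fun x hx => ?_
  have hx' : x - v.Xb *ᵥ (v.Yb *ᵥ x) = 0 := by
    simpa [sub_mulVec, mulVec_mulVec] using hx
  by_contra hne
  have h1 := (posDef_iff_quad.1 hpos).2 (Sum.elim (v.Yb *ᵥ x) (-x))
    (sumElim_ne_zero_iff.2 (Or.inr (neg_ne_zero.2 hne)))
  have h2 : fromBlocks v.Xb 1 1 v.Yb *ᵥ Sum.elim (v.Yb *ᵥ x) (-x) = 0 := by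
    rw [fromBlocks_mulVec, ← Sum.elim_zero_zero, Sum.elim_eq_iff]
    simp only [Sum.elim_comp_inl, Sum.elim_comp_inr, one_mulVec, mulVec_neg, add_neg_cancel,
      and_true]
    rw [← sub_eq_add_neg, ← neg_sub, hx', neg_zero]
  rw [quad, h2, dotProduct_zero] at h1
  exact h1.false

theorem isUnit_recU {Z : Matrix (Fin pz) (Fin pz) ℝ} (hΔ : (S.DeltaMat v Z).PosDef)
    (hV : IsUnit V) : IsUnit (recU v V) := by
  rw [recU, ← transpose_nonsing_inv]
  exact (isUnit_one_sub_mul hΔ).mul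
    ((isUnit_transpose _).2 ((isUnit_nonsing_inv_iff).2 hV))

/-- The reconstruction formulas are the linearization equations solved for the controller, and `P`
is solved from `mul_eq`. Its symmetry and definiteness are not needed here: they follow from `Δ ≻ 0`
by congruence. -/
theorem isLinearization_reconstruct (hXb : v.Xb.IsSymm) (hV : IsUnit V)
    (hU : IsUnit (recU v V)) :
    ∃ P, IsLinearization S v (S.reconstruct v V) P (recU v V) V := by
  have hVu : IsUnit Vᵀ.det := by
    rw [det_transpose]
    exact (isUnit_iff_isUnit_det _).1 hV
  have hUu := (isUnit_iff_isUnit_det _).1 hU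
  have hXu := (isUnit_iff_isUnit_det _).1 ((isUnit_fromBlocks_swap v.Xb).2 hU)
  have hUV : recU v V * Vᵀ = 1 - v.Xb * v.Yb := by
    rw [recU, nonsing_inv_mul_cancel_right _ _ hVu]
  have hCt : v.Ct = v.Dc * S.C * v.Yb + (S.reconstruct v V).Cc * Vᵀ := by
    simp only [reconstruct]
    rw [nonsing_inv_mul_cancel_right _ _ hVu, add_sub_cancel]
  refine ⟨fromBlocks 1 v.Yb 0 Vᵀ * (fromBlocks v.Xb 1 (recU v V)ᵀ 0)⁻¹, hXb, ?_, ?_, hU, rfl,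
    hCt, ?_, ?_⟩
  · rw [nonsing_inv_mul_cancel_right _ _ hXu]
  · rw [hUV, add_sub_cancel]
  · simp only [reconstruct, recB]
    rw [mul_nonsing_inv_cancel_left _ _ hUu, add_sub_cancel]
  · simp only [reconstruct]
    rw [← Matrix.mul_assoc, nonsing_inv_mul_cancel_right _ _ hVu,
      mul_nonsing_inv_cancel_left _ _ hUu]
    abel

end Linearization

end Setup

end DataDrivenH2

/-! ### The main theorem -/

open DataDrivenH2 in
theorem theorem2 {k p m mw md N pz pc n q : ℕ} (S : Setup k p m mw md N pz pc n q)
    (hBd0 : S.Bd0.rank = md)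
    (hΦ : S.Φ.IsSymm) (hΦ22 : (-S.Φ.toBlocks₂₂).PosDef)
    (hSVD : S.IsCompactSVD)
    (hrows : LinearIndependent ℝ (fun i : Fin p => S.X (Sum.inl i)))
    (hSigma : S.Sigma.Nonempty)
    (hrank : S.regressor.rank = n + m + mw)
    (hfact : S.IsFactorization)
    (hker : S.IsKernelBasis)
    (μ : ℝ) (Z : Matrix (Fin pz) (Fin pz) ℝ) :
    ((∃ (K : Controller m pc n) (P : Matrix (Fin n ⊕ Fin n) (Fin n ⊕ Fin n) ℝ),
        S.H2Robust μ Z K P) ↔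
      ∃ v : DecisionVars m pc n, S.SynthesisLMI v μ Z) ∧
    (∀ v : DecisionVars m pc n, S.SynthesisLMI v μ Z →
      ∀ V : Matrix (Fin n) (Fin n) ℝ, V.rank = n →
        (Setup.recU v V).rank = n ∧
        ∃ P : Matrix (Fin n ⊕ Fin n) (Fin n ⊕ Fin n) ℝ,
          S.H2Robust μ Z (S.reconstruct v V) P) := by
  have hΓ := S.posDef_neg_Hlow hΦ22 hrank
  have hrec (v : DecisionVars m pc n) (hv : S.SynthesisLMI v μ Z) (V : Matrix (Fin n) (Fin n) ℝ)
      (hVr : V.rank = n) : (Setup.recU v V).rank = n ∧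
        ∃ P : Matrix (Fin n ⊕ Fin n) (Fin n ⊕ Fin n) ℝ,
          S.H2Robust μ Z (S.reconstruct v V) P := by
    obtain ⟨hXb, hYb, hZ, hPi, hΔ⟩ := hv
    have hV : IsUnit V := isUnit_of_rank_eq (by rw [hVr, Fintype.card_fin])
    have hU := Setup.isUnit_recU hΔ hV
    obtain ⟨P, hl⟩ := Setup.isLinearization_reconstruct (S := S) hXb hV hU
    exact ⟨by rw [rank_of_isUnit _ hU, Fintype.card_fin], P,
      Setup.H2Robust_of_certificate hΦ hΦ22 hrank hfact hZ ((hl.posDef_outputMat_iff Z).1 hΔ)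
        ((hl.posDef_lyapunovMat_iff hSVD hrows hker hΓ).1 hPi)⟩
  refine ⟨⟨?_, fun ⟨v, hv⟩ => ?_⟩, hrec⟩
  · rintro ⟨K, P, hK⟩
    obtain ⟨hZ, hout, α, hlyap⟩ :=
      Setup.exists_certificate_of_H2Robust hBd0 hΦ hΦ22 hSigma hrank hfact hK
    obtain ⟨P', hV, hout', hlyap'⟩ := Setup.exists_certificate_isUnit hΓ hfact hout hlyap
    obtain ⟨v, U, hl, hYb, rfl⟩ := Setup.exists_isLinearization (S := S)
      (Setup.posDef_of_outputMat hout') hV K α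
    exact ⟨v, hl.symm_Xb, hYb, hZ, (hl.posDef_lyapunovMat_iff hSVD hrows hker hΓ).2 hlyap',
      (hl.posDef_outputMat_iff Z).2 hout'⟩
  -- Any invertible `V` would do; the identity is the simplest.
  · exact ⟨_, (hrec v hv 1 (by rw [rank_one, Fintype.card_fin])).2⟩
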